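/- **Setting.** Fix a one-dimensional canonical exponential family (laws with densities proportional to $e^{\theta x}$ with respect to a base measure, $\theta$ in the interior of the natural parameter set, indexed by their means, all observations lying in the closure of the set of means). Let $d(p,q)$ be the Kullback–Leibler divergence between the members with means $p$ and $q$, extended by its limit when $p$ is an end point of the set of means. Let $\Theta$ be an open set of means, $\sigma>0$ with $d(p,q)\ge (p-q)^2/(2\sigma^2)$ for all $p,q\in\Theta$, and $[\mu_{\min},\mu_{\max}]\subset\Theta$. A single-answer problem with $K\ge 1$ arms consists of a set $\mathcal M\subseteq[\mu_{\min},\mu_{\max}]^K$, a finite set $\mathcal I$ and a map $i^\star$ giving each $\mu\in\mathcal M$ its unique correct answer $i^\star(\mu)\in\mathcal I$. Write $\neg i=\{\lambda\in\mathcal M: i^\star(\lambda)\ne i\}$ and assume $\mu\notin\mathrm{cl}(\neg i^\star(\mu))$ for all $\mu\in\mathcal M$. Let $\Delta_K$ be the simplex, $$T^\star(\mu)^{-1}=\sup_{\omega\in\Delta_K}\ \inf_{\lambda\in\neg i^\star(\mu)}\ \sum_{k}\omega_k d(\mu_k,\lambda_k)$$ ($=\infty$ if $\neg i^\star(\mu)=\emptyset$),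 and, for any vector $m$ of means, $\omega^\star(m)=\operatorname{argmax}_{\omega\in\Delta_K}\max_{i\in\mathcal I}\inf_{\lambda\in\neg i}\sum_k\omega_k d(m_k,\lambda_k)$. **Algorithm (Track-and-Stop with C-Tracking and projection).** Pull each arm once. Let $N_k(t)$ and $\hat\mu_k(t)$ be the number of pulls and the empirical mean of arm $k$ after $t$ rounds, and $\tilde\mu(t)$ the projection of $\hat\mu(t)$ onto $[\mu_{\min},\mu_{\max}]^K$. For $t\ge K$ choose $\omega(t)\in\omega^\star(\tilde\mu(t))$, let $\tilde\omega(t)$ be an $\ell_\infty$-projection of $\omega(t)$ onto $\Delta_K\cap[\epsilon_t,1]^K$ with $\epsilon_t=\frac12(K^2+t)^{-1/2}$, and pull an arm in $\operatorname{argmax}_k \sum_{s=K}^t\tilde\omega_k(s)-N_k(t)$ (ties broken arbitrarily). For $\delta\in(0,1)$, stop at the first time $\tau_\delta=t\ge K$ such that $\max_{i}\inf_{\lambda\in\neg i}\sum_k N_k(t)d(\hat\mu_k(t),\lambda_k)\ge\beta_{t,\delta}$, where the threshold $\beta_{t,\delta}$ is, for each $\delta\in(0,1)$, nonnegative and concave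 in the integer $t\ge1$ (for example $\beta_{t,\delta}=\log\frac1\delta+K\log(4\log\frac1\delta+1)+6K\log(\log t+3)$). **Theorem.** There are constants $D_K\ge1$ depending only on $K$, and, for every family, $\Theta$, $\sigma$ and $[\mu_{\min},\mu_{\max}]$ as above, constants $C$ and $p\in\mathbb N$ and functions $g=g_K$ of $t$ with $$0\le g(t)\le C\,(1+\log K+\log t)^p\left(K^2\sqrt{D_K t}+\sqrt{D_K t^{3/2}}\right)\qquad(K,t\ge1),$$ such that for every $K\ge 1$, every single-answer problem with $K$ arms, every $\mu\in\mathcal M$, every such threshold, and every $\delta\in(0,1)$, $$\mathbb E_\mu[\tau_\delta]\le 10K^4+\frac{\pi^2}{24}+T_0(\delta),\qquad T_0(\delta)=\inf\left\{t\ge1:\ \beta_{t,\delta}\le(t-\sqrt t-1)\,T^\star(\mu)^{-1}-g(t)\right\}.$$ If moreover for every $\varepsilon>0$ there is a constant $c$ with $\beta_{t,\delta}\le(1+\varepsilon)\log\frac1\delta+\varepsilon t+c$ for all $t\ge1$ and $\delta\in(0,1)$ (as for the threshold above), then $T_0(\delta)<\infty$ for all $\delta\in(0,1)$ and the bound recovers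 asymptotic optimality: $$\limsup_{\delta\to0}\frac{10K^4+\pi^2/24+T_0(\delta)}{\log(1/\delta)}\le T^\star(\mu),\qquad \limsup_{\delta\to0}\frac{\mathbb E_\mu[\tau_\delta]}{\log(1/\delta)}\le T^\star(\mu).$$ -/

import Mathlib

open MeasureTheory Filter Topology
open scoped ENNReal

namespace TrackStop

noncomputable section

/-! ### Canonical exponential families -/

/-- Interior of the natural parameter set `{θ | ∫ exp (θ x) dρ(x) < ∞}` of the base measure `ρ`. -/
def naturalSet (ρ : Measure ℝ) : Set ℝ :=
  interior (ProbabilityTheory.integrableExpSet id ρ)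

/-- The law with density `x ↦ exp (θ x - log ∫ exp (θ y) dρ(y))` with respect to `ρ`. -/
def naturalLaw (ρ : Measure ℝ) (θ : ℝ) : Measure ℝ :=
  ρ.tilted (fun x => θ * x)

/-- The mean of the law with natural parameter `θ`. -/
def meanOf (ρ : Measure ℝ) (θ : ℝ) : ℝ :=
  ∫ x, x ∂(naturalLaw ρ θ)

/-- The set of all means of the family generated by `ρ`. -/
def meanSpaceOf (ρ : Measure ℝ) : Set ℝ :=
  meanOf ρ '' naturalSet ρ

/-- A one-dimensional canonical exponential family, given by its base measure. The base measure is
not concentrated on one point, and observations lie in the closure of the set of means (automatic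
when the natural parameter set is open), so that divergences of empirical means make sense. -/
structure CanonicalExpFamily where
  base : Measure ℝ
  nondegenerate : ∀ c : ℝ, ¬ ∀ᵐ x ∂base, x = c
  support_subset : ∀ᵐ x ∂base, x ∈ closure (meanSpaceOf base)

namespace CanonicalExpFamily

variable (F : CanonicalExpFamily)

def meanSpace : Set ℝ := meanSpaceOf F.base

/-- The natural parameter of the member of the family with mean `p`. -/
def natParam (p : ℝ) : ℝ :=
  Function.invFunOn (meanOf F.base) (naturalSet F.base) p

/-- The member of the family with mean `p`. -/
def law (p : ℝ) : Measure ℝ := naturalLaw F.base (F.natParam p)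

open Classical in
/-- The Kullback-Leibler divergence between the members with means `p` and `q`. In the first
argument it is extended by its limit to the end points of the set of means, where empirical means
can lie. -/
def kl (p q : ℝ) : ℝ≥0∞ :=
  if p ∈ F.meanSpace then InformationTheory.klDiv (F.law p) (F.law q)
  else liminf (fun p' => InformationTheory.klDiv (F.law p') (F.law q)) (𝓝[F.meanSpace] p)

/-- The family is `σ²`-sub-Gaussian on `Θ`. -/
def SubGaussianOn (Θ : Set ℝ) (σ : ℝ) : Prop :=
  ∀ p ∈ Θ, ∀ q ∈ Θ, ENNReal.ofReal ((p - q) ^ 2 / (2 * σ ^ 2)) ≤ F.kl p q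

/-- `∑ k, ω k * d(μ k, l k)`. -/
def weightedKL {K : ℕ} (ω μ l : Fin K → ℝ) : ℝ≥0∞ :=
  ∑ k, ENNReal.ofReal (ω k) * F.kl (μ k) (l k)

end CanonicalExpFamily

/-! ### Pure exploration problems -/

/-- A set of bandit models (vectors of means) and, for every model, its set of correct answers. -/
structure Problem (K : ℕ) (I : Type*) where
  models : Set (Fin K → ℝ)
  correct : (Fin K → ℝ) → Set I
  separated : ∀ μ ∈ models, ∃ i ∈ correct μ, μ ∉ closure {l ∈ models | i ∉ correct l}

namespace Problem

variable {K : ℕ} {I : Type*} (Q : Problem K I) (F : CanonicalExpFamily)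

/-- The models for which `i` is not a correct answer. -/
def alt (i : I) : Set (Fin K → ℝ) := {l ∈ Q.models | i ∉ Q.correct l}

def SingleAnswer : Prop := ∀ μ ∈ Q.models, ∃ i, Q.correct μ = {i}

/-- The information `inf_{l ∈ ¬i} ∑ k, ω k * d(μ k, l k)` against the alternatives to `i`. -/
def info (ω μ : Fin K → ℝ) (i : I) : ℝ≥0∞ := ⨅ l ∈ Q.alt i, F.weightedKL ω μ l

/-- The inverse characteristic time `T*(μ)⁻¹`; it is `∞` if the answer is the same for all models. -/
def invCharTime (μ : Fin K → ℝ) : ℝ≥0∞ :=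
  ⨆ ω ∈ stdSimplex ℝ (Fin K), ⨆ i ∈ Q.correct μ, Q.info F ω μ i

/-- The oracle weights of an arbitrary vector of means, possibly outside the set of models. -/
def oracleWeights (μ : Fin K → ℝ) : Set (Fin K → ℝ) :=
  {ω ∈ stdSimplex ℝ (Fin K) |
    ∀ ω' ∈ stdSimplex ℝ (Fin K), (⨆ i, Q.info F ω' μ i) ≤ ⨆ i, Q.info F ω μ i}

end Problem

/-! ### The interaction and the algorithm; rounds are numbered `1, 2, …` -/

section Run

variable {Ω : Type*} {K : ℕ} (A : ℕ → Ω → Fin K) (X : ℕ → Ω → ℝ)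

/-- The `σ`-field generated by `A 1, X 1, …, A t, X t`. -/
abbrev history (t : ℕ) : MeasurableSpace Ω :=
  ⨆ s ∈ Finset.Icc 1 t,
    (MeasurableSpace.comap (A s) inferInstance ⊔ MeasurableSpace.comap (X s) inferInstance)

/-- The number of pulls of arm `k` up to time `t`. -/
def pulls (t : ℕ) (x : Ω) (k : Fin K) : ℕ := {s ∈ Finset.Icc 1 t | A s x = k}.card

/-- The empirical mean of arm `k` at time `t`. -/
def empMean (t : ℕ) (x : Ω) (k : Fin K) : ℝ :=
  (∑ s ∈ Finset.Icc 1 t with A s x = k, X s x) / (pulls A t x k : ℝ)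

/-- The orthogonal projection of the empirical means onto the cube `[a, b]^K`. -/
def projMean (a b : ℝ) (t : ℕ) (x : Ω) (k : Fin K) : ℝ :=
  max a (min b (empMean A X t x k))

/-- `A` and `X` are the actions and observations of an interaction with the bandit `μ`: the action
`A (t + 1)` is a function of the first `t` rounds and, given these, `X (t + 1)` is distributed as
the arm `A (t + 1)`. -/
structure IsInteraction [MeasurableSpace Ω] (F : CanonicalExpFamily) (P : Measure Ω)
    (μ : Fin K → ℝ) : Prop where
  observation_measurable : ∀ t, Measurable (X (t + 1))
  action_measurable : ∀ t, Measurable[history A X t] (A (t + 1))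
  observation_law : ∀ (t : ℕ) (H : Set Ω), MeasurableSet[history A X t] H →
    ∀ (k : Fin K) (B : Set ℝ), MeasurableSet B →
      P (H ∩ {x | A (t + 1) x = k ∧ X (t + 1) x ∈ B})
        = P (H ∩ {x | A (t + 1) x = k}) * F.law (μ k) B

/-- The simplex with all coordinates at least `ε`. -/
def truncSimplex (K : ℕ) (ε : ℝ) : Set (Fin K → ℝ) :=
  {v ∈ stdSimplex ℝ (Fin K) | ∀ k, ε ≤ v k}

/-- The forced exploration rate `ε_t = (K² + t)^(-1/2) / 2`. -/
def forcedRate (K t : ℕ) : ℝ := (Real.sqrt ((K : ℝ) ^ 2 + t))⁻¹ / 2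

/-- `v` is a projection of `w` onto `S` for the `ℓ_∞` norm (the norm of `Fin K → ℝ`). -/
def IsSupProj (S : Set (Fin K → ℝ)) (w v : Fin K → ℝ) : Prop :=
  v ∈ S ∧ ∀ u ∈ S, ‖v - w‖ ≤ ‖u - w‖

/-- The sampling rule of Track-and-Stop with C-Tracking and projected empirical means: every arm is
pulled once in the first `K` rounds; from time `K` on, `w t` are oracle weights of the projected
empirical means, `v t` is their projection onto the truncated simplex, and the next action
maximizes `∑_{s=K}^t v s k - N_k(t)`. Ties are broken arbitrarily. -/
def IsTaSSampling {I : Type*} (F : CanonicalExpFamily) (Q : Problem K I) (a b : ℝ) : Prop :=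
  (∀ x k, pulls A K x k = 1) ∧
  ∃ w v : ℕ → Ω → Fin K → ℝ, ∀ t, K ≤ t → ∀ x,
    w t x ∈ Q.oracleWeights F (projMean A X a b t x) ∧
    IsSupProj (truncSimplex K (forcedRate K t)) (w t x) (v t x) ∧
    ∀ k, (∑ s ∈ Finset.Icc K t, v s x k) - (pulls A t x k : ℝ)
      ≤ (∑ s ∈ Finset.Icc K t, v s x (A (t + 1) x)) - (pulls A t x (A (t + 1) x) : ℝ)

/-- The statistic `max_i inf_{l ∈ ¬i} ∑ k, N_k(t) * d(empirical mean of k, l k)`. -/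
def stopStat {I : Type*} (F : CanonicalExpFamily) (Q : Problem K I) (t : ℕ) (x : Ω) : ℝ≥0∞ :=
  ⨆ i, Q.info F (fun k => (pulls A t x k : ℝ)) (empMean A X t x) i

/-- The stopping time `τ_δ` for the threshold `t ↦ β t δ`, tested after the initialization. -/
def stopTime {I : Type*} (F : CanonicalExpFamily) (Q : Problem K I) (β : ℕ → ℝ → ℝ) (δ : ℝ)
    (x : Ω) : ℕ∞ :=
  ⨅ t ∈ {t : ℕ | K ≤ t ∧ ENNReal.ofReal (β t δ) ≤ stopStat A X F Q t x}, (t : ℕ∞)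

/-- The expected stopping time. -/
def expectedStop [MeasurableSpace Ω] {I : Type*} (F : CanonicalExpFamily) (Q : Problem K I)
    (β : ℕ → ℝ → ℝ) (P : Measure Ω) (δ : ℝ) : ℝ≥0∞ :=
  ∫⁻ x, (stopTime A X F Q β δ x : ℝ≥0∞) ∂P

end Run

/-! ### Thresholds and the bound -/

/-- Stopping thresholds that are nonnegative and concave in `t`. -/
structure IsThreshold (β : ℕ → ℝ → ℝ) : Prop where
  nonneg : ∀ δ ∈ Set.Ioo (0 : ℝ) 1, ∀ t, 1 ≤ t → 0 ≤ β t δ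
  concave : ∀ δ ∈ Set.Ioo (0 : ℝ) 1, ∀ t, 1 ≤ t → β (t + 2) δ - β (t + 1) δ ≤ β (t + 1) δ - β t δ

/-- `β t δ` is at most `log (1/δ)` up to a negligible factor and a term sublinear in `t`. -/
def IsCalibrated (β : ℕ → ℝ → ℝ) : Prop :=
  ∀ ε > 0, ∃ c : ℝ, ∀ δ ∈ Set.Ioo (0 : ℝ) 1, ∀ t : ℕ, 1 ≤ t →
    β t δ ≤ (1 + ε) * Real.log (1 / δ) + ε * t + c

/-- The time `T₀(δ)`, for `Tinv = T*(μ)⁻¹`: the first `t ≥ 1` with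
`β t δ ≤ (t - √t - 1) Tinv - g t`. -/
def boundTime (β : ℕ → ℝ → ℝ) (g : ℕ → ℝ) (Tinv : ℝ≥0∞) (δ : ℝ) : ℕ∞ :=
  ⨅ t ∈ {t : ℕ | 1 ≤ t ∧
    ((β t δ : ℝ) : EReal) ≤ (((t : ℝ) - Real.sqrt t - 1 : ℝ) : EReal) * (Tinv : EReal)
      - ((g t : ℝ) : EReal)}, (t : ℕ∞)

/-- `10 K⁴ + π²/24 + T₀(δ)`. -/
def stopBound (K : ℕ) (β : ℕ → ℝ → ℝ) (g : ℕ → ℝ) (Tinv : ℝ≥0∞) (δ : ℝ) : ℝ≥0∞ :=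
  10 * (K : ℝ≥0∞) ^ 4 + ENNReal.ofReal (Real.pi ^ 2 / 24) + (boundTime β g Tinv δ : ℝ≥0∞)

end

end TrackStop

namespace TrackStop

open ProbabilityTheory

/-! ### Divergences in a canonical exponential family -/

namespace CanonicalExpFamily

variable (F : CanonicalExpFamily)

/-! The heart of the proof is that, outside a bad event of probability at most 1/(4t²), the stopping
statistic at time t is at least (t - √t - 1)/T* - g(t), with g of order t^(3/4) up to logarithms and
powers of K (`ofReal_le_info`). Once this lower bound exceeds the threshold it does so at all later
times (`IsThreshold.le_of_le`, from concavity and nonnegativity of the threshold). Past T₀, the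
algorithm can therefore miss a stop only at times whose bad event occurs. The expected number of
these is at most the sum of 1/(4t²), which is π²/24; the term 10K⁴ covers the K initial rounds.

The lower bound on the statistic combines three facts. C-Tracking with forced exploration gives
N_k(s) ≥ √s/(6K) (`sqrt_div_le_pulls`), so a Chernoff bound, uniform over arms, times and pull
counts, puts every empirical mean within a logarithm times K s^(-1/4) of the truth
(`abs_empMean_sub_le`). Oracle weights computed at distance Δ from μ lose at most 2BΔ of information
against any alternative to the answer of μ, where B is the range of the natural parameter over the
cube (`invCharTime_le_of_mem_oracleWeights`); no continuity of ω* is involved, since only values are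
compared. Finally the pulls follow the summed weights up to K√t + K (`sum_weights_le_pulls`).
Summing s^(-1/4) over the rounds gives the t^(3/4) of g; tracking and the replacement of means in
the statistic cost √t up to logarithms and powers of K.

If the answer has no alternative, the statistic is infinite; otherwise T*⁻¹ is finite, and it is
always positive by separation. Since √t and g are sublinear, T₀ is at most (1+ε)/(T*⁻¹ - 2ε)
log(1/δ) plus a constant when T*⁻¹ is finite, and ε → 0 gives asymptotic optimality. -/

/-- The log-partition function of the family. -/
noncomputable def logPartition (θ : ℝ) : ℝ := Real.log (∫ x, Real.exp (θ * x) ∂F.base)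

/-- The closed form of the divergence between the members with means `p` and `q`. -/
noncomputable def divergence (p q : ℝ) : ℝ :=
  (F.natParam p - F.natParam q) * p - F.logPartition (F.natParam p)
    + F.logPartition (F.natParam q)

variable {F}

lemma base_ne_zero : F.base ≠ 0 := fun h => F.nondegenerate 0 (by simp [h])

lemma natParam_mem {p : ℝ} (hp : p ∈ F.meanSpace) : F.natParam p ∈ naturalSet F.base :=
  Function.invFunOn_mem hp

lemma meanOf_natParam {p : ℝ} (hp : p ∈ F.meanSpace) : meanOf F.base (F.natParam p) = p :=
  Function.invFunOn_eq hp

lemma integrable_exp_of_mem_naturalSet {θ : ℝ} (h : θ ∈ naturalSet F.base) :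
    Integrable (fun x => Real.exp (θ * x)) F.base :=
  integrable_of_mem_integrableExpSet (X := id) (interior_subset h)

lemma isProbabilityMeasure_naturalLaw {θ : ℝ} (h : θ ∈ naturalSet F.base) :
    IsProbabilityMeasure (naturalLaw F.base θ) :=
  haveI : NeZero F.base := ⟨base_ne_zero⟩
  isProbabilityMeasure_tilted (integrable_exp_of_mem_naturalSet h)

lemma integrable_id_naturalLaw {θ : ℝ} (h : θ ∈ naturalSet F.base) :
    Integrable (fun x : ℝ => x) (naturalLaw F.base θ) := by
  unfold naturalLaw
  rw [integrable_tilted_iff (integrable_exp_of_mem_naturalSet h)]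
  have := integrable_pow_mul_exp_of_mem_interior_integrableExpSet (X := id) (μ := F.base) h 1
  simpa [mul_comm] using this

lemma partition_pos {θ : ℝ} (h : θ ∈ naturalSet F.base) :
    0 < ∫ x, Real.exp (θ * x) ∂F.base :=
  haveI : NeZero F.base := ⟨base_ne_zero⟩
  integral_exp_pos (integrable_exp_of_mem_naturalSet h)

lemma naturalLaw_tilted {θ₀ : ℝ} (h₀ : θ₀ ∈ naturalSet F.base) (θ : ℝ) :
    (naturalLaw F.base θ₀).tilted (fun x => (θ - θ₀) * x) = naturalLaw F.base θ := by
  unfold naturalLaw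
  rw [tilted_tilted (integrable_exp_of_mem_naturalSet h₀)]
  congr 1
  ext x
  simp only [Pi.add_apply]
  ring

lemma integral_exp_naturalLaw {θ₀ : ℝ} (θ : ℝ) :
    ∫ x, Real.exp ((θ - θ₀) * x) ∂(naturalLaw F.base θ₀)
      = (∫ x, Real.exp (θ * x) ∂F.base) / ∫ x, Real.exp (θ₀ * x) ∂F.base := by
  unfold naturalLaw
  rw [integral_exp_tilted]
  congr 2
  ext x
  simp only [Pi.add_apply]
  ring_nf

lemma integrable_exp_naturalLaw {θ₀ θ : ℝ} (h₀ : θ₀ ∈ naturalSet F.base)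
    (h : θ ∈ naturalSet F.base) :
    Integrable (fun x => Real.exp ((θ - θ₀) * x)) (naturalLaw F.base θ₀) := by
  unfold naturalLaw
  rw [integrable_tilted_iff (integrable_exp_of_mem_naturalSet h₀)]
  refine (integrable_exp_of_mem_naturalSet h).congr (ae_of_all _ fun x => ?_)
  simp only [smul_eq_mul, ← Real.exp_add]
  ring_nf

/-- The moment generating function of a member of the family. -/
lemma lintegral_exp_law {p : ℝ} (hp : p ∈ F.meanSpace) {θ : ℝ} (h : θ ∈ naturalSet F.base) :
    ∫⁻ x, ENNReal.ofReal (Real.exp ((θ - F.natParam p) * x)) ∂(F.law p)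
      = ENNReal.ofReal (Real.exp (F.logPartition θ - F.logPartition (F.natParam p))) := by
  unfold law
  rw [← ofReal_integral_eq_lintegral_ofReal (integrable_exp_naturalLaw (natParam_mem hp) h)
    (ae_of_all _ fun x => (Real.exp_pos _).le), integral_exp_naturalLaw, Real.exp_sub,
    logPartition, logPartition, Real.exp_log (partition_pos h),
    Real.exp_log (partition_pos (natParam_mem hp))]

lemma isProbabilityMeasure_law {p : ℝ} (hp : p ∈ F.meanSpace) :
    IsProbabilityMeasure (F.law p) :=
  isProbabilityMeasure_naturalLaw (natParam_mem hp)

/-- One law is an exponential tilt of the other, so the log-likelihood ratio is affine in the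
observation and its expectation depends on the first law only through its mean. -/
lemma klDiv_law {p q : ℝ} (hp : p ∈ F.meanSpace) (hq : q ∈ F.meanSpace) :
    0 ≤ F.divergence p q ∧
      InformationTheory.klDiv (F.law p) (F.law q) = ENNReal.ofReal (F.divergence p q) := by
  have hθp := natParam_mem hp
  have hθq := natParam_mem hq
  have := isProbabilityMeasure_law hp
  have := isProbabilityMeasure_law hq
  set c := F.natParam p - F.natParam q with hc
  have htilt : (F.law q).tilted (fun x => c * x) = F.law p := naturalLaw_tilted hθq _
  have hint : Integrable (fun x => Real.exp (c * x)) (F.law q) := integrable_exp_naturalLaw hθq hθp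
  have hac : F.law p ≪ F.law q := htilt ▸ tilted_absolutelyContinuous _ _
  have hllr : llr (F.law p) (F.law q) =ᵐ[F.law p]
      fun x => c * x - (F.logPartition (F.natParam p) - F.logPartition (F.natParam q)) := by
    refine hac.ae_le ?_
    have h := log_rnDeriv_tilted_left_self hint
    rw [htilt] at h
    filter_upwards [h] with x hx
    rw [llr, hx]
    congr 1
    unfold law
    rw [integral_exp_naturalLaw,
      Real.log_div (partition_pos hθp).ne' (partition_pos hθq).ne']
    rfl
  have hid : Integrable (fun x : ℝ => x) (F.law p) := integrable_id_naturalLaw hθp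
  have hint' : Integrable (llr (F.law p) (F.law q)) (F.law p) :=
    (integrable_congr hllr).2 ((hid.const_mul c).sub (integrable_const _))
  have hval : ∫ x, llr (F.law p) (F.law q) x ∂(F.law p) = F.divergence p q := by
    rw [integral_congr_ae hllr, integral_sub (hid.const_mul c) (integrable_const _),
      integral_const_mul, integral_const]
    have : ∫ x, x ∂(F.law p) = p := meanOf_natParam hp
    rw [this]
    simp [divergence, hc]
    ring
  have h1 := InformationTheory.klDiv_of_ac_of_integrable hac hint'
  have h2 := InformationTheory.integral_llr_add_sub_measure_univ_nonneg hac hint'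
  rw [hval] at h1 h2
  simp only [probReal_univ, add_sub_cancel_right] at h1 h2
  exact ⟨h2, h1⟩

lemma divergence_nonneg {p q : ℝ} (hp : p ∈ F.meanSpace) (hq : q ∈ F.meanSpace) :
    0 ≤ F.divergence p q := (klDiv_law hp hq).1

lemma kl_eq_divergence {p q : ℝ} (hp : p ∈ F.meanSpace) (hq : q ∈ F.meanSpace) :
    F.kl p q = ENNReal.ofReal (F.divergence p q) := by
  rw [kl, if_pos hp, (klDiv_law hp hq).2]

/-- Three-point identity of Bregman divergences, the source of all the comparisons below. -/
lemma divergence_add (p p' q : ℝ) :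
    F.divergence p' q
      = F.divergence p q + (F.natParam p - F.natParam q) * (p' - p) + F.divergence p' p := by
  unfold divergence
  ring

/-- The right side is the symmetrized divergence, whose other half is nonnegative. -/
lemma divergence_le_mul {p q : ℝ} (hp : p ∈ F.meanSpace) (hq : q ∈ F.meanSpace) :
    F.divergence p q ≤ (F.natParam p - F.natParam q) * (p - q) := by
  have h1 := divergence_add (F := F) q p q
  have h2 := divergence_nonneg hq hp
  unfold divergence at *
  nlinarith

lemma natParam_le {p q : ℝ} (hp : p ∈ F.meanSpace) (hq : q ∈ F.meanSpace) (h : p < q) :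
    F.natParam p ≤ F.natParam q := by
  have h1 := divergence_le_mul hp hq
  have h2 := divergence_nonneg hp hq
  by_contra hlt
  push Not at hlt
  nlinarith

lemma abs_natParam_sub_le {a b p q : ℝ} (hab : Set.Icc a b ⊆ F.meanSpace)
    (hp : p ∈ Set.Icc a b) (hq : q ∈ Set.Icc a b) :
    |F.natParam p - F.natParam q| ≤ F.natParam b - F.natParam a := by
  have hle : a ≤ b := hp.1.trans hp.2
  have key : ∀ p ∈ Set.Icc a b, F.natParam a ≤ F.natParam p ∧ F.natParam p ≤ F.natParam b := by
    intro p hp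
    refine ⟨?_, ?_⟩
    · rcases hp.1.eq_or_lt with h | h
      · rw [h]
      · exact natParam_le (hab ⟨le_rfl, hle⟩) (hab hp) h
    · rcases hp.2.eq_or_lt with h | h
      · rw [h]
      · exact natParam_le (hab hp) (hab ⟨hle, le_rfl⟩) h
  have h1 := key p hp
  have h2 := key q hq
  rw [abs_le]
  constructor <;> linarith

lemma divergence_le_mul_abs {a b p q : ℝ} (hab : Set.Icc a b ⊆ F.meanSpace)
    (hp : p ∈ Set.Icc a b) (hq : q ∈ Set.Icc a b) :
    F.divergence p q ≤ (F.natParam b - F.natParam a) * |p - q| := by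
  refine (divergence_le_mul (hab hp) (hab hq)).trans ((le_abs_self _).trans ?_)
  rw [abs_mul]
  exact mul_le_mul_of_nonneg_right (abs_natParam_sub_le hab hp hq) (abs_nonneg _)

/-- Drop the nonnegative d(x, p) in the three-point identity. Here x is not confined to the
interval, since empirical means may leave it. -/
lemma divergence_lipschitz {a b p q x : ℝ} (hab : Set.Icc a b ⊆ F.meanSpace)
    (hp : p ∈ Set.Icc a b) (hq : q ∈ Set.Icc a b) (hx : x ∈ F.meanSpace) :
    F.divergence p q - (F.natParam b - F.natParam a) * |x - p| ≤ F.divergence x q := by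
  have h1 := divergence_add (F := F) p x q
  have h2 := divergence_nonneg hx (hab hp)
  have h3 : |(F.natParam p - F.natParam q) * (x - p)|
      ≤ (F.natParam b - F.natParam a) * |x - p| := by
    rw [abs_mul]
    exact mul_le_mul_of_nonneg_right (abs_natParam_sub_le hab hp hq) (abs_nonneg _)
  have h4 := (abs_le.1 h3).1
  linarith

/-- The divergence in its first argument is bounded below by an affine function of the distance,
also at the end points of the set of means and outside its closure. -/
lemma ofReal_divergence_sub_le_kl {a b p q : ℝ} (hab : Set.Icc a b ⊆ F.meanSpace)
    (hp : p ∈ Set.Icc a b) (hq : q ∈ Set.Icc a b) (x : ℝ) :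
    ENNReal.ofReal (F.divergence p q - (F.natParam b - F.natParam a) * |x - p|) ≤ F.kl x q := by
  by_cases hx : x ∈ F.meanSpace
  · rw [kl_eq_divergence hx (hab hq)]
    exact ENNReal.ofReal_le_ofReal (divergence_lipschitz hab hp hq hx)
  rw [kl, if_neg hx]
  -- Outside the closure of the set of means the liminf is along the trivial filter and equals ∞.
  rcases (𝓝[F.meanSpace] x).eq_or_neBot with h | h
  · rw [h]
    simp
  have ht : Tendsto (fun y => ENNReal.ofReal
      (F.divergence p q - (F.natParam b - F.natParam a) * |y - p|)) (𝓝[F.meanSpace] x)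
      (𝓝 (ENNReal.ofReal (F.divergence p q - (F.natParam b - F.natParam a) * |x - p|))) := by
    refine Tendsto.mono_left (Continuous.tendsto ?_ x) nhdsWithin_le_nhds
    exact ENNReal.continuous_ofReal.comp (by fun_prop)
  rw [← ht.liminf_eq]
  refine liminf_le_liminf ?_
  filter_upwards [self_mem_nhdsWithin] with y hy
  rw [(klDiv_law hy (hab hq)).2]
  exact ENNReal.ofReal_le_ofReal (divergence_lipschitz hab hp hq hy)

lemma SubGaussianOn.le_divergence {Θ : Set ℝ} {σ : ℝ} (h : F.SubGaussianOn Θ σ)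
    (hΘ : Θ ⊆ F.meanSpace) {p q : ℝ} (hp : p ∈ Θ) (hq : q ∈ Θ) :
    (p - q) ^ 2 / (2 * σ ^ 2) ≤ F.divergence p q := by
  have h1 := h p hp q hq
  rw [kl_eq_divergence (hΘ hp) (hΘ hq)] at h1
  exact (ENNReal.ofReal_le_ofReal_iff (divergence_nonneg (hΘ hp) (hΘ hq))).1 h1

/-- The Chernoff exponent, linear beyond the radius in which the sub-Gaussian bound holds. -/
lemma SubGaussianOn.chernoff_exponent {Θ : Set ℝ} {σ : ℝ} (h : F.SubGaussianOn Θ σ) (hσ : 0 < σ)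
    (hΘ : Θ ⊆ F.meanSpace) {m y r e : ℝ} (hm : m ∈ Θ) (he : e = 1 ∨ e = -1)
    (hmy : m + e * y ∈ Θ) (hy : 0 < y) (hyr : y ≤ r) :
    0 ≤ (F.natParam (m + e * y) - F.natParam m) * e ∧
    y * r / (2 * σ ^ 2) ≤ (F.natParam (m + e * y) - F.natParam m) * (m + e * r)
      - (F.logPartition (F.natParam (m + e * y)) - F.logPartition (F.natParam m)) := by
  have h1 := h.le_divergence hΘ hmy hm
  have h2 := divergence_nonneg (hΘ hm) (hΘ hmy)
  have h3 := divergence_le_mul (hΘ hmy) (hΘ hm)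
  have hee : e ^ 2 = 1 := by rcases he with rfl | rfl <;> norm_num
  have h5 : (m + e * y - m) ^ 2 = y ^ 2 := by ring_nf; rw [hee]; ring
  rw [h5] at h1
  have hσ2 : 0 < 2 * σ ^ 2 := by positivity
  set L := F.natParam (m + e * y) - F.natParam m with hL
  have h6 : y / (2 * σ ^ 2) ≤ L * e := by
    have : y * (y / (2 * σ ^ 2)) ≤ y * (L * e) := by
      calc y * (y / (2 * σ ^ 2)) = y ^ 2 / (2 * σ ^ 2) := by ring
        _ ≤ _ := h1
        _ ≤ _ := h3
        _ = _ := by ring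
    exact le_of_mul_le_mul_left this hy
  refine ⟨le_trans (by positivity) h6, ?_⟩
  have h7 : F.divergence (m + e * y) m = L * (m + e * y)
      - (F.logPartition (F.natParam (m + e * y)) - F.logPartition (F.natParam m)) := by
    unfold divergence; ring
  have h8 : (y / (2 * σ ^ 2)) * (r - y) ≤ L * e * (r - y) :=
    mul_le_mul_of_nonneg_right h6 (by linarith)
  have h9 : y * r / (2 * σ ^ 2) = y ^ 2 / (2 * σ ^ 2) + (y / (2 * σ ^ 2)) * (r - y) := by ring
  rw [h9]
  have h10 : L * (m + e * r) = L * (m + e * y) + L * e * (r - y) := by ring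
  linarith

end CanonicalExpFamily

/-! ### Concentration of the empirical means -/

section Concentration

variable {Ω : Type*} {K : ℕ} {A : ℕ → Ω → Fin K} {X : ℕ → Ω → ℝ}

/-- The sum of the observations of arm `k` up to time `t`. -/
noncomputable def armSum (A : ℕ → Ω → Fin K) (X : ℕ → Ω → ℝ) (t : ℕ) (x : Ω) (k : Fin K) : ℝ :=
  ∑ s ∈ Finset.Icc 1 t with A s x = k, X s x

lemma pulls_zero (x : Ω) (k : Fin K) : pulls A 0 x k = 0 := by simp [pulls]

lemma armSum_zero (x : Ω) (k : Fin K) : armSum A X 0 x k = 0 := by simp [armSum]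

lemma pulls_succ (t : ℕ) (x : Ω) (k : Fin K) :
    pulls A (t + 1) x k = pulls A t x k + if A (t + 1) x = k then 1 else 0 := by
  unfold pulls
  rw [← Finset.insert_Icc_right_eq_Icc_add_one (by omega), Finset.filter_insert]
  split_ifs
  · rw [Finset.card_insert_of_notMem (by simp)]
  · rfl

lemma armSum_succ (t : ℕ) (x : Ω) (k : Fin K) :
    armSum A X (t + 1) x k = armSum A X t x k + if A (t + 1) x = k then X (t + 1) x else 0 := by
  unfold armSum
  rw [← Finset.insert_Icc_right_eq_Icc_add_one (by omega), Finset.filter_insert]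
  split_ifs
  · rw [Finset.sum_insert (by simp), add_comm]
  · simp

lemma pulls_le (t : ℕ) (x : Ω) (k : Fin K) : pulls A t x k ≤ t := by
  simpa [pulls] using Finset.card_filter_le (Finset.Icc 1 t) (fun s => A s x = k)

lemma sum_pulls (t : ℕ) (x : Ω) : ∑ k, pulls A t x k = t := by
  induction t with
  | zero => simp [pulls_zero]
  | succ t ih => simp [pulls_succ, Finset.sum_add_distrib, ih]

lemma history_mono {s t : ℕ} (h : s ≤ t) : history A X s ≤ history A X t :=
  biSup_mono fun i hi => by
    rw [Finset.mem_Icc] at hi ⊢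
    omega

lemma comap_le_history (t : ℕ) :
    MeasurableSpace.comap (A (t + 1)) inferInstance
        ⊔ MeasurableSpace.comap (X (t + 1)) inferInstance
      ≤ history A X (t + 1) :=
  le_biSup (fun s => MeasurableSpace.comap (A s) inferInstance
    ⊔ MeasurableSpace.comap (X s) inferInstance) (by simp)

lemma measurable_action_history (t : ℕ) : Measurable[history A X (t + 1)] (A (t + 1)) :=
  (comap_measurable (A (t + 1))).mono (le_sup_left.trans (comap_le_history t)) le_rfl

lemma measurable_observation_history (t : ℕ) : Measurable[history A X (t + 1)] (X (t + 1)) :=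
  (comap_measurable (X (t + 1))).mono (le_sup_right.trans (comap_le_history t)) le_rfl

lemma measurable_pulls (t : ℕ) (k : Fin K) :
    Measurable[history A X t] (fun x => pulls A t x k) := by
  induction t with
  | zero => simp only [pulls_zero]; exact @measurable_const _ _ _ (_) _
  | succ t ih =>
    simp only [pulls_succ]
    let _ := history A X (t + 1)
    refine Measurable.add (ih.mono (history_mono (Nat.le_succ t)) le_rfl) ?_
    exact Measurable.ite (measurable_action_history t (measurableSet_singleton k))
      measurable_const measurable_const

lemma measurable_armSum (t : ℕ) (k : Fin K) :
    Measurable[history A X t] (fun x => armSum A X t x k) := by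
  induction t with
  | zero => simp only [armSum_zero]; exact @measurable_const _ _ _ (_) _
  | succ t ih =>
    simp only [armSum_succ]
    let _ := history A X (t + 1)
    refine Measurable.add (ih.mono (history_mono (Nat.le_succ t)) le_rfl) ?_
    exact Measurable.ite (measurable_action_history t (measurableSet_singleton k))
      (measurable_observation_history t) measurable_const

variable [mΩ : MeasurableSpace Ω] {F : CanonicalExpFamily} {P : Measure Ω} {μ : Fin K → ℝ}

lemma IsInteraction.history_le (h : IsInteraction A X F P μ) (t : ℕ) : history A X t ≤ mΩ := by
  induction t with
  | zero => simp [history]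
  | succ t ih =>
    refine iSup₂_le fun s hs => ?_
    rw [Finset.mem_Icc] at hs
    obtain ⟨s, rfl⟩ : ∃ r, s = r + 1 := ⟨s - 1, by omega⟩
    refine sup_le ?_ (h.observation_measurable s).comap_le
    refine Measurable.comap_le ?_
    exact (h.action_measurable s).mono ((history_mono (by omega)).trans ih) le_rfl

/-- On the event that arm k is played, weighting by g of the observation and multiplying by the mean
of g give measures that agree on the history, so they integrate history-measurable functions alike.
-/
lemma IsInteraction.lintegral_mul_observation [IsProbabilityMeasure P]
    (h : IsInteraction A X F P μ) (t : ℕ) (k : Fin K) {f : Ω → ℝ≥0∞}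
    (hf : Measurable[history A X t] f) {g : ℝ → ℝ≥0∞} (hg : Measurable g) :
    ∫⁻ x in {x | A (t + 1) x = k}, f x * g (X (t + 1) x) ∂P
      = (∫⁻ x in {x | A (t + 1) x = k}, f x ∂P) * ∫⁻ y, g y ∂(F.law (μ k)) := by
  have hle := h.history_le t
  have hk : MeasurableSet[history A X t] {x | A (t + 1) x = k} :=
    h.action_measurable t (measurableSet_singleton k)
  have hX := h.observation_measurable t
  set Pk := P.restrict {x | A (t + 1) x = k} with hPk
  set c := ∫⁻ y, g y ∂(F.law (μ k)) with hc
  have hset : ∀ H, MeasurableSet[history A X t] H →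
      ∫⁻ x in H, g (X (t + 1) x) ∂Pk = c * Pk H := by
    intro H hH
    have hmap : (Pk.restrict H).map (X (t + 1)) = (Pk H) • F.law (μ k) := by
      ext B hB
      rw [Measure.map_apply hX hB, Measure.restrict_apply (hX hB), hPk,
        Measure.restrict_apply ((hX hB).inter (hle _ hH)), Measure.smul_apply, smul_eq_mul,
        Measure.restrict_apply (hle _ hH), ← h.observation_law t H hH k B hB]
      congr 1
      ext x
      simp only [Set.mem_inter_iff, Set.mem_preimage, Set.mem_ofPred_eq]
      tauto
    rw [← lintegral_map hg hX, hmap, lintegral_smul_measure, smul_eq_mul, mul_comm]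
  have htrim : (Pk.withDensity (fun x => g (X (t + 1) x))).trim hle = (c • Pk).trim hle := by
    refine @Measure.ext _ (history A X t) _ _ fun H hH => ?_
    rw [trim_measurableSet_eq hle hH, trim_measurableSet_eq hle hH,
      withDensity_apply _ (hle _ hH), hset H hH, Measure.smul_apply, smul_eq_mul]
  calc ∫⁻ x, f x * g (X (t + 1) x) ∂Pk
      = ∫⁻ x, f x ∂(Pk.withDensity (fun x => g (X (t + 1) x))) := by
        rw [lintegral_withDensity_eq_lintegral_mul _ (f := fun x => g (X (t + 1) x))
          (hg.comp hX) (hf.mono hle le_rfl)]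
        simp only [Pi.mul_apply, mul_comm]
    _ = ∫⁻ x, f x ∂(c • Pk) := by
        rw [← lintegral_trim hle hf, htrim, lintegral_trim hle hf]
    _ = (∫⁻ x, f x ∂Pk) * c := by
        rw [lintegral_smul_measure, smul_eq_mul, mul_comm]

/-- The exponential martingale of the observations of one arm. -/
noncomputable def expWeight (A : ℕ → Ω → Fin K) (X : ℕ → Ω → ℝ) (k : Fin K) (c φ : ℝ) (t : ℕ)
    (x : Ω) : ℝ≥0∞ :=
  ENNReal.ofReal (Real.exp (c * armSum A X t x k - pulls A t x k * φ))

omit mΩ in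
lemma measurable_expWeight (k : Fin K) (c φ : ℝ) (t : ℕ) :
    Measurable[history A X t] (expWeight A X k c φ t) := by
  let _ := history A X t
  have h1 : Measurable (fun x => armSum A X t x k) := measurable_armSum t k
  have h2 : Measurable (fun x => (pulls A t x k : ℝ)) :=
    measurable_from_nat.comp (measurable_pulls t k)
  exact ENNReal.measurable_ofReal.comp (Real.measurable_exp.comp
    ((h1.const_mul c).sub (h2.mul_const φ)))

/-- A play of arm k multiplies the weight by a factor of conditional mean one; a play of another arm
leaves it unchanged. -/
lemma IsInteraction.lintegral_expWeight [IsProbabilityMeasure P]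
    (h : IsInteraction A X F P μ) (k : Fin K) {c φ : ℝ}
    (hφ : ∫⁻ y, ENNReal.ofReal (Real.exp (c * y)) ∂(F.law (μ k)) = ENNReal.ofReal (Real.exp φ))
    (t : ℕ) : ∫⁻ x, expWeight A X k c φ t x ∂P = 1 := by
  induction t with
  | zero => simp [expWeight, armSum_zero, pulls_zero]
  | succ t ih =>
    have hk : MeasurableSet {x | A (t + 1) x = k} :=
      h.history_le t _ (h.action_measurable t (measurableSet_singleton k))
    rw [← ih, ← lintegral_add_compl _ hk, ← lintegral_add_compl (expWeight A X k c φ t) hk]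
    congr 1
    · have h1 : ∫⁻ y, ENNReal.ofReal (Real.exp (c * y - φ)) ∂(F.law (μ k)) = 1 := by
        simp only [sub_eq_add_neg, Real.exp_add, ENNReal.ofReal_mul (Real.exp_pos _).le]
        rw [lintegral_mul_const _ (by fun_prop), hφ, ← ENNReal.ofReal_mul (Real.exp_pos _).le,
          ← Real.exp_add]
        simp
      have h2 := h.lintegral_mul_observation t k (measurable_expWeight k c φ t)
        (g := fun y => ENNReal.ofReal (Real.exp (c * y - φ))) (by fun_prop)
      rw [h1, mul_one] at h2
      rw [← h2]
      refine setLIntegral_congr_fun hk fun x hx => ?_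
      have hx : A (t + 1) x = k := hx
      simp only [expWeight]
      rw [← ENNReal.ofReal_mul (Real.exp_pos _).le, ← Real.exp_add, armSum_succ, pulls_succ,
        if_pos hx, if_pos hx]
      congr 2
      push_cast
      ring
    · refine setLIntegral_congr_fun hk.compl fun x hx => ?_
      have hx : ¬ A (t + 1) x = k := hx
      simp only [expWeight]
      rw [armSum_succ, pulls_succ, if_neg hx, if_neg hx]
      simp

/-- Chernoff bound for the mean of one arm, when it has been pulled `n` times. -/
lemma IsInteraction.measure_deviation_le [IsProbabilityMeasure P]
    (h : IsInteraction A X F P μ) {Θ : Set ℝ} {σ : ℝ} (hS : F.SubGaussianOn Θ σ) (hσ : 0 < σ)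
    (hΘ : Θ ⊆ F.meanSpace) (k : Fin K) {y r e : ℝ} (hm : μ k ∈ Θ) (he : e = 1 ∨ e = -1)
    (hmy : μ k + e * y ∈ Θ) (hy : 0 < y) (hyr : y ≤ r) (t n : ℕ) :
    P {x | pulls A t x k = n ∧ n * r ≤ e * (armSum A X t x k - n * μ k)}
      ≤ ENNReal.ofReal (Real.exp (-(n * (y * r / (2 * σ ^ 2))))) := by
  obtain ⟨h1, h2⟩ := hS.chernoff_exponent hσ hΘ hm he hmy hy hyr
  set c := F.natParam (μ k + e * y) - F.natParam (μ k) with hc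
  set φ := F.logPartition (F.natParam (μ k + e * y)) - F.logPartition (F.natParam (μ k)) with hφ
  have hee : e * e = 1 := by rcases he with rfl | rfl <;> norm_num
  have hint := h.lintegral_expWeight k (c := c) (φ := φ)
    (CanonicalExpFamily.lintegral_exp_law (hΘ hm)
      (CanonicalExpFamily.natParam_mem (hΘ hmy))) t
  -- On the event that the pull count equals n the compensator is deterministic, so Markov's
  -- inequality at a fixed time suffices.
  have hmark := meas_ge_le_lintegral_div
    ((measurable_expWeight (A := A) (X := X) k c φ t).mono (h.history_le t) le_rfl).aemeasurable
    (μ := P) (ε := ENNReal.ofReal (Real.exp (n * (y * r / (2 * σ ^ 2)))))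
    (by simp [Real.exp_pos]) (by simp)
  rw [hint] at hmark
  refine (measure_mono ?_).trans (hmark.trans_eq ?_)
  · rintro x ⟨hn, hx⟩
    refine ENNReal.ofReal_le_ofReal (Real.exp_le_exp.2 ?_)
    rw [hn]
    have h3 : (n : ℝ) * (y * r / (2 * σ ^ 2)) ≤ n * (c * (μ k + e * r) - φ) :=
      mul_le_mul_of_nonneg_left h2 (Nat.cast_nonneg n)
    have h4 : 0 ≤ (c * e) * (e * (armSum A X t x k - n * μ k) - n * r) :=
      mul_nonneg h1 (by linarith)
    have h5 : (c * e) * (e * (armSum A X t x k - n * μ k) - n * r)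
        = c * (e * e) * (armSum A X t x k - n * μ k) - n * (c * (e * r)) := by ring
    rw [h5, hee] at h4
    linarith
  · rw [Real.exp_neg, ENNReal.ofReal_inv_of_pos (Real.exp_pos _), one_div]

/-- The deviation that the sum of `n` observations exceeds with probability at most
`2 * exp (-u)`. -/
noncomputable def deviation (σ η u n : ℝ) : ℝ :=
  2 * σ ^ 2 * u / min η (Real.sqrt (2 * σ ^ 2 * u / n))

/-- Some arm deviates from its mean before time `t`. -/
def badEvent (A : ℕ → Ω → Fin K) (X : ℕ → Ω → ℝ) (μ : Fin K → ℝ) (σ η u : ℝ) (t : ℕ) : Set Ω :=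
  ⋃ k : Fin K, ⋃ s ∈ Finset.Icc 1 t, ⋃ n ∈ Finset.Icc 1 t,
    ({x | pulls A s x k = n ∧ n * (deviation σ η u n / n) ≤ 1 * (armSum A X s x k - n * μ k)} ∪
     {x | pulls A s x k = n ∧ n * (deviation σ η u n / n) ≤ -1 * (armSum A X s x k - n * μ k)})

lemma IsInteraction.measurableSet_badEvent (h : IsInteraction A X F P μ) (σ η u : ℝ) (t : ℕ) :
    MeasurableSet (badEvent A X μ σ η u t) := by
  refine MeasurableSet.iUnion fun k => Finset.measurableSet_biUnion _ fun s _ =>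
    Finset.measurableSet_biUnion _ fun n _ => ?_
  have h1 : Measurable (fun x => armSum A X s x k) := (measurable_armSum s k).mono
    (h.history_le s) le_rfl
  have h2 : Measurable (fun x => pulls A s x k) := (measurable_pulls s k).mono
    (h.history_le s) le_rfl
  have h3 : MeasurableSet {x | pulls A s x k = n} := h2 (measurableSet_singleton n)
  exact (h3.inter (measurableSet_le measurable_const ((h1.sub_const _).const_mul _))).union
    (h3.inter (measurableSet_le measurable_const ((h1.sub_const _).const_mul _)))

lemma IsInteraction.measure_badEvent_le [IsProbabilityMeasure P]
    (h : IsInteraction A X F P μ) {Θ : Set ℝ} {σ η u : ℝ} (hS : F.SubGaussianOn Θ σ) (hσ : 0 < σ)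
    (hΘ : Θ ⊆ F.meanSpace) (hη : 0 < η) (hu : 0 < u)
    (hμ : ∀ k, Set.Icc (μ k - η) (μ k + η) ⊆ Θ) (t : ℕ) :
    P (badEvent A X μ σ η u t) ≤ K * (t * (t * (2 * ENNReal.ofReal (Real.exp (-u))))) := by
  unfold badEvent
  refine (measure_iUnion_fintype_le _ _).trans ?_
  refine (Finset.sum_le_card_nsmul _ _ (t * (t * (2 * ENNReal.ofReal (Real.exp (-u)))))
    fun k _ => ?_).trans (by simp)
  refine (measure_biUnion_finset_le _ _).trans ?_
  refine (Finset.sum_le_card_nsmul _ _ (t * (2 * ENNReal.ofReal (Real.exp (-u))))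
    fun s _ => ?_).trans (by simp)
  refine (measure_biUnion_finset_le _ _).trans ?_
  refine (Finset.sum_le_card_nsmul _ _ (2 * ENNReal.ofReal (Real.exp (-u)))
    fun n hn => ?_).trans (by simp)
  have hn : (0 : ℝ) < n := by
    rw [Finset.mem_Icc] at hn
    exact_mod_cast hn.1
  refine (measure_union_le _ _).trans ?_
  rw [two_mul]
  -- The tilt aims at the mean μ_k ± y, which must stay in Θ: hence the cap η. Without the cap, y
  -- equals the radius r = `deviation`/n; in both regimes n y r/(2σ²) = u.
  set y := min η (Real.sqrt (2 * σ ^ 2 * u / n)) with hy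
  have hV : 0 < 2 * σ ^ 2 * u / n := by positivity
  have hy0 : 0 < y := lt_min hη (Real.sqrt_pos.2 hV)
  have hdev : deviation σ η u n = 2 * σ ^ 2 * u / y := rfl
  have hyr : y ≤ deviation σ η u n / n := by
    rw [hdev, div_div, mul_comm y, ← div_div, le_div_iff₀ hy0]
    calc y * y ≤ Real.sqrt (2 * σ ^ 2 * u / n) * Real.sqrt (2 * σ ^ 2 * u / n) :=
          mul_self_le_mul_self hy0.le (min_le_right _ _)
      _ = _ := Real.mul_self_sqrt hV.le
  have hexp : (n : ℝ) * (y * (deviation σ η u n / n) / (2 * σ ^ 2)) = u := by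
    rw [hdev]
    field_simp
  have hyη : y ≤ η := min_le_left _ _
  have hmem : ∀ e : ℝ, e = 1 ∨ e = -1 → μ k + e * y ∈ Θ := by
    rintro e (rfl | rfl) <;> refine hμ k ⟨?_, ?_⟩ <;> linarith
  have hm : μ k ∈ Θ := hμ k ⟨by linarith, by linarith⟩
  refine add_le_add ?_ ?_
  · have := h.measure_deviation_le hS hσ hΘ k hm (Or.inl rfl) (hmem 1 (Or.inl rfl)) hy0 hyr s n
    rwa [hexp] at this
  · have := h.measure_deviation_le hS hσ hΘ k hm (Or.inr rfl) (hmem _ (Or.inr rfl)) hy0 hyr s n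
    rwa [hexp] at this

omit mΩ in
lemma deviation_le {σ η u n : ℝ} (hσ : 0 < σ) (hη : 0 < η) (hu : 0 < u) (hn : 0 < n) :
    deviation σ η u n ≤ 2 * σ ^ 2 * u / η + Real.sqrt (2 * σ ^ 2 * u * n) := by
  unfold deviation
  have hV : 0 < 2 * σ ^ 2 * u := by positivity
  rcases le_total η (Real.sqrt (2 * σ ^ 2 * u / n)) with h | h
  · rw [min_eq_left h]
    linarith [Real.sqrt_nonneg (2 * σ ^ 2 * u * n)]
  · rw [min_eq_right h]
    have : 2 * σ ^ 2 * u / Real.sqrt (2 * σ ^ 2 * u / n) = Real.sqrt (2 * σ ^ 2 * u * n) := by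
      rw [div_eq_iff (Real.sqrt_pos.2 (by positivity)).ne', ← Real.sqrt_mul (by positivity)]
      rw [show 2 * σ ^ 2 * u * n * (2 * σ ^ 2 * u / n) = (2 * σ ^ 2 * u) ^ 2 by field_simp]
      exact (Real.sqrt_sq hV.le).symm
    rw [this]
    have : 0 ≤ 2 * σ ^ 2 * u / η := by positivity
    linarith

omit mΩ in
lemma mul_abs_empMean_sub_le {σ η u : ℝ} (hσ : 0 < σ) (hη : 0 < η) (hu : 0 < u) {t s : ℕ} {x : Ω}
    (hx : x ∉ badEvent A X μ σ η u t) (hs : s ∈ Finset.Icc 1 t) {k : Fin K}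
    (hk : 1 ≤ pulls A s x k) :
    pulls A s x k * |empMean A X s x k - μ k|
      ≤ 2 * σ ^ 2 * u / η + Real.sqrt (2 * σ ^ 2 * u * pulls A s x k) := by
  have hk0 : (0 : ℝ) < pulls A s x k := by exact_mod_cast hk
  refine le_trans ?_ (deviation_le hσ hη hu hk0)
  have hn : pulls A s x k ∈ Finset.Icc 1 t := by
    rw [Finset.mem_Icc] at hs ⊢
    exact ⟨hk, (pulls_le s x k).trans hs.2⟩
  simp only [badEvent, Set.mem_iUnion, not_exists, Set.mem_union, not_or, Set.mem_ofPred_eq] at hx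
  obtain ⟨h1, h2⟩ := hx k s hs _ hn
  rw [mul_div_cancel₀ _ hk0.ne'] at h1 h2
  simp only [true_and, not_le] at h1 h2
  have : (pulls A s x k : ℝ) * |empMean A X s x k - μ k|
      = |armSum A X s x k - pulls A s x k * μ k| := by
    rw [← abs_of_pos hk0, ← abs_mul, abs_of_pos hk0, empMean, mul_sub, mul_div_cancel₀ _ hk0.ne']
    rfl
  rw [this, abs_le]
  constructor <;> linarith

end Concentration

/-! ### C-Tracking and forced exploration -/

section Tracking

variable {Ω : Type*} {K : ℕ} {A : ℕ → Ω → Fin K} {x : Ω} {v w : ℕ → Fin K → ℝ}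

lemma sum_sum_of_mem_stdSimplex (hv : ∀ t, K ≤ t → v t ∈ stdSimplex ℝ (Fin K)) {t : ℕ}
    (ht : K ≤ t) : ∑ k, ∑ s ∈ Finset.Ico K t, v s k = (t : ℝ) - K := by
  rw [Finset.sum_comm, Finset.sum_congr rfl fun s hs => (hv s (Finset.mem_Ico.1 hs).1).2]
  simp [Nat.cast_sub ht]

/-- Before each pull the K gaps between summed weights and pulls add up to 1 - K, so the largest,
that of the pulled arm, exceeds -1. The pull then lowers it by one. -/
lemma pulls_le_tracked (hK : 1 ≤ K) (hinit : ∀ k, pulls A K x k = 1)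
    (hv : ∀ t, K ≤ t → v t ∈ stdSimplex ℝ (Fin K))
    (hmax : ∀ t, K ≤ t → ∀ k, (∑ s ∈ Finset.Icc K t, v s k) - (pulls A t x k : ℝ)
      ≤ (∑ s ∈ Finset.Icc K t, v s (A (t + 1) x)) - (pulls A t x (A (t + 1) x) : ℝ))
    {t : ℕ} (ht : K ≤ t) (k : Fin K) :
    (pulls A t x k : ℝ) ≤ (∑ s ∈ Finset.Ico K t, v s k) + 2 := by
  induction t, ht using Nat.le_induction generalizing k with
  | base => simp [hinit]
  | succ t ht ih =>
    have hstep : ∑ s ∈ Finset.Ico K (t + 1), v s k = (∑ s ∈ Finset.Ico K t, v s k) + v t k :=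
      Finset.sum_Ico_succ_top ht _
    have hvk := (hv t ht).1 k
    rw [pulls_succ]
    split_ifs with hA
    · have hm := hmax t ht
      rw [hA] at hm
      have hs : ∑ j, ((∑ s ∈ Finset.Icc K t, v s j) - (pulls A t x j : ℝ)) = 1 - K := by
        have h1 := sum_sum_of_mem_stdSimplex hv (le_trans ht (Nat.le_succ t))
        rw [Finset.sum_sub_distrib, ← Nat.cast_sum, sum_pulls]
        have : Finset.Icc K t = Finset.Ico K (t + 1) := by ext; simp
        rw [this, h1]
        push_cast
        ring
      have hle := Finset.sum_le_card_nsmul Finset.univ _ _ fun j _ => hm j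
      rw [hs] at hle
      simp only [Finset.card_univ, Fintype.card_fin, nsmul_eq_mul] at hle
      have hI : Finset.Icc K t = Finset.Ico K (t + 1) := by ext; simp
      rw [hI] at hle
      have hK' : (1 : ℝ) ≤ K := by exact_mod_cast hK
      have : -1 ≤ (∑ s ∈ Finset.Ico K (t + 1), v s k) - (pulls A t x k : ℝ) := by
        by_contra hcon
        push Not at hcon
        nlinarith
      push_cast
      linarith
    · rw [hstep]
      push_cast
      have := ih k
      linarith

/-- The slacks in `pulls_le_tracked` are nonnegative and sum to K, so each is at most K. -/
lemma tracked_le_pulls (hK : 1 ≤ K) (hinit : ∀ k, pulls A K x k = 1)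
    (hv : ∀ t, K ≤ t → v t ∈ stdSimplex ℝ (Fin K))
    (hmax : ∀ t, K ≤ t → ∀ k, (∑ s ∈ Finset.Icc K t, v s k) - (pulls A t x k : ℝ)
      ≤ (∑ s ∈ Finset.Icc K t, v s (A (t + 1) x)) - (pulls A t x (A (t + 1) x) : ℝ))
    {t : ℕ} (ht : K ≤ t) (k : Fin K) :
    (∑ s ∈ Finset.Ico K t, v s k) - K ≤ pulls A t x k := by
  have h1 : ∑ j, ((∑ s ∈ Finset.Ico K t, v s j) + 2 - (pulls A t x j : ℝ)) = K := by
    rw [Finset.sum_sub_distrib, ← Nat.cast_sum, sum_pulls, Finset.sum_add_distrib,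
      sum_sum_of_mem_stdSimplex hv ht]
    simp
    ring
  have h2 := Finset.single_le_sum
    (f := fun j => (∑ s ∈ Finset.Ico K t, v s j) + 2 - (pulls A t x j : ℝ))
    (fun j _ => by
      have := pulls_le_tracked hK hinit hv hmax ht j
      linarith) (Finset.mem_univ k)
  rw [h1] at h2
  linarith

lemma one_le_pulls (hinit : ∀ k, pulls A K x k = 1) {t : ℕ} (ht : K ≤ t) (k : Fin K) :
    1 ≤ pulls A t x k := by
  induction t, ht using Nat.le_induction with
  | base => simp [hinit]
  | succ t ht ih => rw [pulls_succ]; omega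

/-- The rate is the derivative of √(K² + t), so the sum dominates its telescoping increments. -/
lemma sqrt_sub_le_sum_forcedRate {t : ℕ} (hK : 1 ≤ K) (ht : K ≤ t) :
    Real.sqrt t - 2 * K ≤ ∑ s ∈ Finset.Ico K t, forcedRate K s := by
  have hK' : (1 : ℝ) ≤ K := by exact_mod_cast hK
  have key : Real.sqrt ((K : ℝ) ^ 2 + t) - 2 * K ≤ ∑ s ∈ Finset.Ico K t, forcedRate K s := by
    induction t, ht using Nat.le_induction with
    | base =>
      simp only [Finset.Ico_self, Finset.sum_empty, sub_nonpos]
      refine Real.sqrt_le_iff.2 ⟨by linarith, ?_⟩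
      nlinarith
    | succ t ht ih =>
      rw [Finset.sum_Ico_succ_top ht]
      have h0 : 0 < (K : ℝ) ^ 2 + t := by positivity
      have h1 : Real.sqrt ((K : ℝ) ^ 2 + (t + 1 : ℕ)) ≤
          Real.sqrt ((K : ℝ) ^ 2 + t) + forcedRate K t := by
        unfold forcedRate
        refine Real.sqrt_le_iff.2 ⟨by positivity, ?_⟩
        set q := Real.sqrt ((K : ℝ) ^ 2 + t) with hq
        have hqpos : 0 < q := Real.sqrt_pos.2 h0
        have hq2 : q ^ 2 = (K : ℝ) ^ 2 + t := Real.sq_sqrt h0.le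
        have : (q + q⁻¹ / 2) ^ 2 = q ^ 2 + 1 + (q⁻¹ / 2) ^ 2 := by
          field_simp
          ring
        rw [this, hq2]
        push_cast
        nlinarith [sq_nonneg (q⁻¹ / 2)]
      linarith
  refine le_trans ?_ key
  have : Real.sqrt t ≤ Real.sqrt ((K : ℝ) ^ 2 + t) := Real.sqrt_le_sqrt (by nlinarith)
  linarith

lemma sum_forcedRate_le {t : ℕ} (hK : 1 ≤ K) (ht : K ≤ t) :
    ∑ s ∈ Finset.Ico K t, forcedRate K s ≤ Real.sqrt t := by
  induction t, ht using Nat.le_induction with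
  | base => simp
  | succ t ht ih =>
    rw [Finset.sum_Ico_succ_top ht]
    have ht0 : (0 : ℝ) ≤ t := Nat.cast_nonneg t
    have hK' : (1 : ℝ) ≤ K := by exact_mod_cast hK
    have h1 : forcedRate K t ≤ (Real.sqrt (t + 1))⁻¹ / 2 := by
      unfold forcedRate
      have : Real.sqrt (t + 1) ≤ Real.sqrt ((K : ℝ) ^ 2 + t) := Real.sqrt_le_sqrt (by nlinarith)
      have h0 : 0 < Real.sqrt ((t : ℝ) + 1) := Real.sqrt_pos.2 (by positivity)
      gcongr
    have h2 : Real.sqrt t + (Real.sqrt (t + 1))⁻¹ / 2 ≤ Real.sqrt (t + 1) := by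
      set q := Real.sqrt ((t : ℝ) + 1) with hq
      have hqpos : 0 < q := Real.sqrt_pos.2 (by positivity)
      have hq2 : q ^ 2 = (t : ℝ) + 1 := Real.sq_sqrt (by positivity)
      have hq1 : 1 ≤ q := by
        rw [hq]
        exact Real.one_le_sqrt.2 (by linarith)
      have hinv : q⁻¹ ≤ 1 := inv_le_one_of_one_le₀ hq1
      have h3 : Real.sqrt t ≤ q - q⁻¹ / 2 := by
        refine Real.sqrt_le_iff.2 ⟨by linarith, ?_⟩
        have : (q - q⁻¹ / 2) ^ 2 = q ^ 2 - 1 + (q⁻¹ / 2) ^ 2 := by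
          field_simp
          ring
        rw [this, hq2]
        nlinarith [sq_nonneg (q⁻¹ / 2)]
      linarith
    push_cast
    linarith

/-- Forced exploration. -/
lemma sqrt_div_le_pulls (hK : 1 ≤ K) (hinit : ∀ k, pulls A K x k = 1)
    (hv : ∀ t, K ≤ t → v t ∈ truncSimplex K (forcedRate K t))
    (hmax : ∀ t, K ≤ t → ∀ k, (∑ s ∈ Finset.Icc K t, v s k) - (pulls A t x k : ℝ)
      ≤ (∑ s ∈ Finset.Icc K t, v s (A (t + 1) x)) - (pulls A t x (A (t + 1) x) : ℝ))
    {t : ℕ} (ht : K ≤ t) (k : Fin K) :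
    Real.sqrt t / (6 * K) ≤ pulls A t x k := by
  have hK' : (1 : ℝ) ≤ K := by exact_mod_cast hK
  have h1 := tracked_le_pulls hK hinit (fun t ht => (hv t ht).1) hmax ht k
  have h2 : (1 : ℝ) ≤ pulls A t x k := by exact_mod_cast one_le_pulls hinit ht k
  have h3 : ∑ s ∈ Finset.Ico K t, forcedRate K s ≤ ∑ s ∈ Finset.Ico K t, v s k :=
    Finset.sum_le_sum fun s hs => (hv s (Finset.mem_Ico.1 hs).1).2 k
  have h4 := sqrt_sub_le_sum_forcedRate hK ht
  rw [div_le_iff₀ (by positivity)]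
  -- For small t the initial pull suffices; afterwards √t - 3K ≥ √t/2.
  rcases le_total (Real.sqrt t) (6 * K) with h | h
  · nlinarith
  · nlinarith

/-- The projection does at least as well as the feasible point (1 - Kε)w + ε. -/
lemma norm_sub_le_of_isSupProj {ε : ℝ} {w v : Fin K → ℝ} (hε : 0 ≤ ε) (hKε : K * ε ≤ 1)
    (hw : w ∈ stdSimplex ℝ (Fin K)) (h : IsSupProj (truncSimplex K ε) w v) :
    ‖v - w‖ ≤ K * ε := by
  set u : Fin K → ℝ := fun k => (1 - K * ε) * w k + ε with hu
  have hu0 : ∀ k, ε ≤ u k := fun k =>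
    le_add_of_nonneg_left (mul_nonneg (by linarith) (hw.1 k))
  have hmem : u ∈ truncSimplex K ε := by
    refine ⟨⟨fun k => hε.trans (hu0 k), ?_⟩, hu0⟩
    simp [hu, Finset.sum_add_distrib, ← Finset.mul_sum, hw.2]
  refine (h.2 u hmem).trans ((pi_norm_le_iff_of_nonneg (by positivity)).2 fun k => ?_)
  have hK' : (1 : ℝ) ≤ K := by exact_mod_cast Fin.pos k
  have h0 := hw.1 k
  have h1 : w k ≤ 1 := hw.2 ▸ Finset.single_le_sum (fun j _ => hw.1 j) (Finset.mem_univ k)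
  have h2 : u k - w k = ε * (1 - K * w k) := by simp only [hu]; ring
  rw [Pi.sub_apply, h2, Real.norm_eq_abs, abs_mul, abs_of_nonneg hε, mul_comm]
  refine mul_le_mul_of_nonneg_right (abs_le.2 ⟨?_, ?_⟩) hε <;> nlinarith

lemma forcedRate_nonneg (t : ℕ) : 0 ≤ forcedRate K t := by
  unfold forcedRate
  positivity

lemma mul_forcedRate_le (hK : 1 ≤ K) (t : ℕ) : K * forcedRate K t ≤ 1 := by
  have hK' : (1 : ℝ) ≤ K := by exact_mod_cast hK
  have h1 : (K : ℝ) ≤ Real.sqrt ((K : ℝ) ^ 2 + t) := Real.le_sqrt_of_sq_le (by simp)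
  have h2 : (Real.sqrt ((K : ℝ) ^ 2 + t))⁻¹ ≤ (K : ℝ)⁻¹ := by gcongr
  have h3 : (K : ℝ) * (Real.sqrt ((K : ℝ) ^ 2 + t))⁻¹ ≤ K * (K : ℝ)⁻¹ := by gcongr
  rw [mul_inv_cancel₀ (by positivity)] at h3
  unfold forcedRate
  linarith

/-- The number of pulls follows the sum of the weights before projection. -/
lemma sum_weights_le_pulls (hK : 1 ≤ K) (hinit : ∀ k, pulls A K x k = 1)
    (hw : ∀ t, K ≤ t → w t ∈ stdSimplex ℝ (Fin K))
    (hv : ∀ t, K ≤ t → IsSupProj (truncSimplex K (forcedRate K t)) (w t) (v t))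
    (hmax : ∀ t, K ≤ t → ∀ k, (∑ s ∈ Finset.Icc K t, v s k) - (pulls A t x k : ℝ)
      ≤ (∑ s ∈ Finset.Icc K t, v s (A (t + 1) x)) - (pulls A t x (A (t + 1) x) : ℝ))
    {t : ℕ} (ht : K ≤ t) (k : Fin K) :
    (∑ s ∈ Finset.Ico K t, w s k) - (K * Real.sqrt t + K) ≤ pulls A t x k := by
  have h1 := tracked_le_pulls hK hinit (fun t ht => (hv t ht).1.1) hmax ht k
  have h2 : ∑ s ∈ Finset.Ico K t, w s k
      ≤ ∑ s ∈ Finset.Ico K t, (v s k + K * forcedRate K s) := by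
    refine Finset.sum_le_sum fun s hs => ?_
    have hs := (Finset.mem_Ico.1 hs).1
    have h3 := norm_sub_le_of_isSupProj (forcedRate_nonneg s) (mul_forcedRate_le hK s)
      (hw s hs) (hv s hs)
    have h4 := (norm_le_pi_norm (v s - w s) k).trans h3
    rw [Pi.sub_apply, Real.norm_eq_abs] at h4
    have h5 := (abs_le.1 h4).1
    linarith
  rw [Finset.sum_add_distrib, ← Finset.mul_sum] at h2
  have h6 := mul_le_mul_of_nonneg_left (sum_forcedRate_le hK ht) (Nat.cast_nonneg (α := ℝ) K)
  linarith

end Tracking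

/-! ### Stability of the information and of the characteristic time -/

section Information

variable {K : ℕ} {I : Type*} {Q : Problem K I} {F : CanonicalExpFamily} {a b : ℝ}

lemma Problem.mem_alt_of_ne {μ : Fin K → ℝ} (hμ : μ ∈ Q.models)
    {i j : I} (hi : Q.correct μ = {i}) (hj : j ≠ i) : μ ∈ Q.alt j :=
  ⟨hμ, by rw [hi]; simpa using hj⟩

namespace CanonicalExpFamily

lemma weightedKL_eq_ofReal {ω p l : Fin K → ℝ} (hω : ∀ k, 0 ≤ ω k) (hp : ∀ k, p k ∈ F.meanSpace)
    (hl : ∀ k, l k ∈ F.meanSpace) :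
    F.weightedKL ω p l = ENNReal.ofReal (∑ k, ω k * F.divergence (p k) (l k)) := by
  unfold weightedKL
  rw [ENNReal.ofReal_sum_of_nonneg fun k _ => mul_nonneg (hω k) (divergence_nonneg (hp k) (hl k))]
  exact Finset.sum_congr rfl fun k _ => by
    rw [kl_eq_divergence (hp k) (hl k), ENNReal.ofReal_mul (hω k)]

lemma ofReal_le_weightedKL (hab : Set.Icc a b ⊆ F.meanSpace) {ω p l : Fin K → ℝ}
    (hω : ∀ k, 0 ≤ ω k) (hp : ∀ k, p k ∈ Set.Icc a b) (hl : ∀ k, l k ∈ Set.Icc a b)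
    (x : Fin K → ℝ) :
    ENNReal.ofReal (∑ k, ω k * (F.divergence (p k) (l k)
      - (F.natParam b - F.natParam a) * |x k - p k|)) ≤ F.weightedKL ω x l := by
  have h : ∀ (s : Finset (Fin K)) (f : Fin K → ℝ),
      ENNReal.ofReal (∑ k ∈ s, f k) ≤ ∑ k ∈ s, ENNReal.ofReal (f k) := fun s f =>
    Finset.le_sum_of_subadditive ENNReal.ofReal ENNReal.ofReal_zero.le
      (fun _ _ => ENNReal.ofReal_add_le) s f
  refine (h _ _).trans (Finset.sum_le_sum fun k _ => ?_)
  rw [ENNReal.ofReal_mul (hω k)]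
  gcongr
  exact ofReal_divergence_sub_le_kl hab (hp k) (hl k) (x k)

lemma sum_mul_divergence_le (hab : Set.Icc a b ⊆ F.meanSpace) {ω p m l : Fin K → ℝ}
    (hω : ω ∈ stdSimplex ℝ (Fin K)) (hp : ∀ k, p k ∈ Set.Icc a b) (hm : ∀ k, m k ∈ Set.Icc a b)
    (hl : ∀ k, l k ∈ Set.Icc a b) {Δ : ℝ} (hΔ : ∀ k, |m k - p k| ≤ Δ)
    (hB : 0 ≤ F.natParam b - F.natParam a) :
    ∑ k, ω k * F.divergence (p k) (l k)
      ≤ ∑ k, ω k * F.divergence (m k) (l k) + (F.natParam b - F.natParam a) * Δ := by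
  have : (F.natParam b - F.natParam a) * Δ = ∑ k, ω k * ((F.natParam b - F.natParam a) * Δ) := by
    rw [← Finset.sum_mul, hω.2, one_mul]
  rw [this, ← Finset.sum_add_distrib]
  refine Finset.sum_le_sum fun k _ => ?_
  rw [← mul_add]
  refine mul_le_mul_of_nonneg_left ?_ (hω.1 k)
  have h1 := divergence_lipschitz hab (hp k) (hl k) (hab (hm k))
  have h2 := mul_le_mul_of_nonneg_left (hΔ k) hB
  linarith

lemma sum_mul_divergence_le_of_abs_le (hab : Set.Icc a b ⊆ F.meanSpace) {ω p m : Fin K → ℝ}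
    (hω : ω ∈ stdSimplex ℝ (Fin K)) (hp : ∀ k, p k ∈ Set.Icc a b) (hm : ∀ k, m k ∈ Set.Icc a b)
    {Δ : ℝ} (hΔ : ∀ k, |m k - p k| ≤ Δ) (hB : 0 ≤ F.natParam b - F.natParam a) :
    ∑ k, ω k * F.divergence (m k) (p k) ≤ (F.natParam b - F.natParam a) * Δ := by
  have : (F.natParam b - F.natParam a) * Δ = ∑ k, ω k * ((F.natParam b - F.natParam a) * Δ) := by
    rw [← Finset.sum_mul, hω.2, one_mul]
  rw [this]
  refine Finset.sum_le_sum fun k _ => mul_le_mul_of_nonneg_left ?_ (hω.1 k)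
  exact (divergence_le_mul_abs hab (hm k) (hp k)).trans (mul_le_mul_of_nonneg_left (hΔ k) hB)

lemma natParam_sub_nonneg (hab : Set.Icc a b ⊆ F.meanSpace) (h : a ≤ b) :
    0 ≤ F.natParam b - F.natParam a :=
  (abs_nonneg _).trans (abs_natParam_sub_le hab (p := a) (q := a) ⟨le_rfl, h⟩ ⟨le_rfl, h⟩)

end CanonicalExpFamily

open CanonicalExpFamily

namespace Problem

lemma info_le_info_add (hab : Set.Icc a b ⊆ F.meanSpace) (h : a ≤ b)
    (hQ : ∀ l ∈ Q.models, ∀ k, l k ∈ Set.Icc a b) {ω p m : Fin K → ℝ}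
    (hω : ω ∈ stdSimplex ℝ (Fin K)) (hp : ∀ k, p k ∈ Set.Icc a b) (hm : ∀ k, m k ∈ Set.Icc a b)
    {Δ : ℝ} (hΔ : ∀ k, |m k - p k| ≤ Δ) (i : I) :
    Q.info F ω p i ≤ Q.info F ω m i + ENNReal.ofReal ((F.natParam b - F.natParam a) * Δ) := by
  rw [← tsub_le_iff_right]
  refine le_iInf₂ fun l hl => ?_
  rw [tsub_le_iff_right]
  have hl' := hQ l hl.1
  refine (iInf₂_le l hl).trans ?_
  rw [weightedKL_eq_ofReal hω.1 (fun k => hab (hp k)) (fun k => hab (hl' k)),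
    weightedKL_eq_ofReal hω.1 (fun k => hab (hm k)) (fun k => hab (hl' k))]
  exact (ENNReal.ofReal_le_ofReal (sum_mul_divergence_le hab hω hp hm hl' hΔ
    (natParam_sub_nonneg hab h))).trans ENNReal.ofReal_add_le

/-- Oracle weights of a vector of means close to `μ` are nearly optimal for `μ`, against every
alternative to its answer. -/
lemma invCharTime_le_of_mem_oracleWeights (hab : Set.Icc a b ⊆ F.meanSpace) (h : a ≤ b)
    (hQ : ∀ l ∈ Q.models, ∀ k, l k ∈ Set.Icc a b) {μ m ω l : Fin K → ℝ}
    (hμ : μ ∈ Q.models) {i : I} (hi : Q.correct μ = {i}) (hm : ∀ k, m k ∈ Set.Icc a b)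
    (hω : ω ∈ Q.oracleWeights F m) (hl : l ∈ Q.alt i) {Δ : ℝ} (hΔ0 : 0 ≤ Δ)
    (hΔ : ∀ k, |m k - μ k| ≤ Δ) :
    Q.invCharTime F μ ≤ ENNReal.ofReal (∑ k, ω k * F.divergence (μ k) (l k)
      + 2 * ((F.natParam b - F.natParam a) * Δ)) := by
  have hB := natParam_sub_nonneg hab h
  have hμ' := hQ μ hμ
  have hl' := hQ l hl.1
  set c := (F.natParam b - F.natParam a) * Δ with hc
  have hc0 : 0 ≤ c := mul_nonneg hB hΔ0
  have hsum0 : 0 ≤ ∑ k, ω k * F.divergence (μ k) (l k) := Finset.sum_nonneg fun k _ =>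
    mul_nonneg (hω.1.1 k) (divergence_nonneg (hab (hμ' k)) (hab (hl' k)))
  have h1 : Q.invCharTime F μ ≤ (⨆ j, Q.info F ω m j) + ENNReal.ofReal c := by
    refine iSup₂_le fun ω' hω' => iSup₂_le fun j _ => ?_
    refine (info_le_info_add hab h hQ hω' hμ' hm hΔ j).trans ?_
    gcongr
    exact (le_iSup (fun j => Q.info F ω' m j) j).trans (hω.2 ω' hω')
  have h2 : (⨆ j, Q.info F ω m j)
      ≤ ENNReal.ofReal (∑ k, ω k * F.divergence (μ k) (l k) + c) := by
    refine iSup_le fun j => ?_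
    by_cases hj : j = i
    · subst hj
      refine (iInf₂_le l hl).trans ?_
      rw [weightedKL_eq_ofReal hω.1.1 (fun k => hab (hm k)) (fun k => hab (hl' k))]
      exact ENNReal.ofReal_le_ofReal (sum_mul_divergence_le hab hω.1 hm hμ' hl'
        (fun k => by rw [abs_sub_comm]; exact hΔ k) hB)
    -- For a wrong answer j, the bandit μ is itself an alternative to j, at divergence at most BΔ
    -- from m. This is where uniqueness of the answer enters.
    · refine (iInf₂_le μ (mem_alt_of_ne hμ hi hj)).trans ?_
      rw [weightedKL_eq_ofReal hω.1.1 (fun k => hab (hm k)) (fun k => hab (hμ' k))]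
      exact ENNReal.ofReal_le_ofReal ((sum_mul_divergence_le_of_abs_le hab hω.1 hμ' hm hΔ hB).trans
        (by linarith))
  refine h1.trans ((add_le_add_left h2 _).trans_eq ?_)
  rw [← ENNReal.ofReal_add (by linarith) hc0]
  congr 1
  ring

lemma invCharTime_le (hab : Set.Icc a b ⊆ F.meanSpace) (h : a ≤ b)
    (hQ : ∀ l ∈ Q.models, ∀ k, l k ∈ Set.Icc a b) {μ l : Fin K → ℝ} (hμ : μ ∈ Q.models) {i : I}
    (hi : Q.correct μ = {i}) (hl : l ∈ Q.alt i) :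
    Q.invCharTime F μ ≤ ENNReal.ofReal ((F.natParam b - F.natParam a) * (b - a)) := by
  have hμ' := hQ μ hμ
  have hl' := hQ l hl.1
  refine iSup₂_le fun ω hω => iSup₂_le fun j hj => ?_
  rw [hi] at hj
  obtain rfl : j = i := hj
  refine (iInf₂_le l hl).trans ?_
  rw [weightedKL_eq_ofReal hω.1 (fun k => hab (hμ' k)) (fun k => hab (hl' k))]
  refine ENNReal.ofReal_le_ofReal (sum_mul_divergence_le_of_abs_le hab hω hl' hμ' (fun k => ?_)
    (natParam_sub_nonneg hab h))
  rw [abs_le]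
  constructor <;> linarith [(hμ' k).1, (hμ' k).2, (hl' k).1, (hl' k).2]

/-- With uniform weights, separation forces a gap ε in some coordinate of every alternative, which
the sub-Gaussian bound turns into information. -/
lemma invCharTime_pos (hK : 1 ≤ K) {Θ : Set ℝ} {σ : ℝ} (hσ : 0 < σ) (hsub : F.SubGaussianOn Θ σ)
    (hΘ : Θ ⊆ F.meanSpace) (hab : Set.Icc a b ⊆ Θ)
    (hQ : ∀ l ∈ Q.models, ∀ k, l k ∈ Set.Icc a b) {μ : Fin K → ℝ} (hμ : μ ∈ Q.models) :
    0 < Q.invCharTime F μ := by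
  obtain ⟨i, hi, hsep⟩ := Q.separated μ hμ
  rw [Metric.mem_closure_iff] at hsep
  push Not at hsep
  obtain ⟨ε, hε, hd⟩ := hsep
  have hK' : (0 : ℝ) < K := by exact_mod_cast hK
  set ω : Fin K → ℝ := fun _ => (K : ℝ)⁻¹ with hω
  have hωm : ω ∈ stdSimplex ℝ (Fin K) :=
    ⟨fun _ => by positivity, by simp [hω, hK'.ne']⟩
  have hpos : 0 < ENNReal.ofReal ((K : ℝ)⁻¹ * (ε ^ 2 / (2 * σ ^ 2))) :=
    ENNReal.ofReal_pos.2 (by positivity)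
  refine hpos.trans_le (le_trans ?_ (le_iSup₂_of_le ω hωm (le_iSup₂_of_le i hi le_rfl)))
  refine le_iInf₂ fun l hl => ?_
  have hl' := hQ l hl.1
  have hμ' := hQ μ hμ
  rw [weightedKL_eq_ofReal hωm.1 (fun k => hΘ (hab (hμ' k))) (fun k => hΘ (hab (hl' k)))]
  refine ENNReal.ofReal_le_ofReal ?_
  obtain ⟨k, hk⟩ : ∃ k, ε ≤ |μ k - l k| := by
    by_contra hcon
    push Not at hcon
    refine absurd (hd l hl) (not_le.2 ?_)
    exact (dist_pi_lt_iff hε).2 fun k => by rw [Real.dist_eq]; exact hcon k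
  have h1 : ε ^ 2 / (2 * σ ^ 2) ≤ F.divergence (μ k) (l k) := by
    refine le_trans ?_ (hsub.le_divergence hΘ (hab (hμ' k)) (hab (hl' k)))
    rw [← sq_abs (μ k - l k)]
    gcongr
  refine le_trans (mul_le_mul_of_nonneg_left h1 (by positivity))
    (Finset.single_le_sum (f := fun k => ω k * F.divergence (μ k) (l k)) (fun j _ => ?_)
      (Finset.mem_univ k))
  exact mul_nonneg (hωm.1 j) (divergence_nonneg (hΘ (hab (hμ' j))) (hΘ (hab (hl' j))))

lemma info_eq_top {ω p : Fin K → ℝ} {i : I} (h : Q.alt i = ∅) : Q.info F ω p i = ⊤ := by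
  simp [info, h]

end Problem

end Information

/-! ### The error term and its elementary estimates -/

section ErrorRate

/-- The error term of the bound on the stopping time. -/
noncomputable def errorRate (C : ℝ) (K t : ℕ) : ℝ :=
  C * K ^ 2 * (4 + Real.log K + Real.log t) * Real.sqrt (Real.sqrt t) ^ 3

/-- The exponent at which the deviation inequalities are used at time `t`. -/
noncomputable def deviationLevel (K t : ℕ) : ℝ := Real.log (8 * K * t ^ 4)

lemma one_le_sqrt_sqrt {t : ℕ} (ht : 1 ≤ t) : 1 ≤ Real.sqrt (Real.sqrt t) :=
  Real.one_le_sqrt.2 (Real.one_le_sqrt.2 (by exact_mod_cast ht))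

lemma sqrt_le_self_of_one_le {u : ℝ} (hu : 1 ≤ u) : Real.sqrt u ≤ u :=
  Real.sqrt_le_iff.2 ⟨by linarith, by nlinarith⟩

lemma sqrt_sqrt_sq (t : ℕ) : Real.sqrt (Real.sqrt t) ^ 2 = Real.sqrt t :=
  Real.sq_sqrt (Real.sqrt_nonneg _)

lemma sqrt_sqrt_pow_four (t : ℕ) : Real.sqrt (Real.sqrt t) ^ 4 = t := by
  rw [show 4 = 2 * 2 from rfl, pow_mul, sqrt_sqrt_sq, Real.sq_sqrt (Nat.cast_nonneg t)]

lemma one_le_deviationLevel {K t : ℕ} (hK : 1 ≤ K) (ht : 1 ≤ t) : 1 ≤ deviationLevel K t := by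
  have hK' : (1 : ℝ) ≤ K := by exact_mod_cast hK
  have ht' : (1 : ℝ) ≤ (t : ℝ) ^ 4 := one_le_pow₀ (by exact_mod_cast ht)
  unfold deviationLevel
  rw [Real.le_log_iff_exp_le (by positivity)]
  have := Real.exp_one_lt_d9
  nlinarith

lemma deviationLevel_le {K t : ℕ} (hK : 1 ≤ K) (ht : 1 ≤ t) :
    deviationLevel K t ≤ 4 * (4 + Real.log K + Real.log t) := by
  have hK' : (0 : ℝ) < K := by exact_mod_cast hK
  have ht' : (0 : ℝ) < t := by exact_mod_cast ht
  have h0 : 0 ≤ Real.log K := Real.log_nonneg (by exact_mod_cast hK)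
  unfold deviationLevel
  rw [Real.log_mul (by positivity) (by positivity), Real.log_mul (by positivity) (by positivity),
    Real.log_pow]
  have : Real.log 8 ≤ 8 - 1 := Real.log_le_sub_one_of_pos (by norm_num)
  push_cast
  linarith

lemma exp_neg_deviationLevel {K t : ℕ} (hK : 1 ≤ K) (ht : 1 ≤ t) :
    Real.exp (-deviationLevel K t) = 1 / (8 * K * t ^ 4) := by
  have hK' : (0 : ℝ) < K := by exact_mod_cast hK
  have ht' : (0 : ℝ) < t := by exact_mod_cast ht
  rw [deviationLevel, Real.exp_neg, Real.exp_log (by positivity), one_div]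

lemma sum_inv_sqrt_sqrt_le {K t : ℕ} (hK : 1 ≤ K) (ht : K ≤ t) :
    ∑ s ∈ Finset.Ico K t, (Real.sqrt (Real.sqrt s))⁻¹ ≤ 4 * Real.sqrt (Real.sqrt t) ^ 3 := by
  induction t, ht using Nat.le_induction with
  | base => simp only [Finset.Ico_self, Finset.sum_empty]; positivity
  | succ t ht ih =>
    rw [Finset.sum_Ico_succ_top ht]
    refine (add_le_add_left ih _).trans ?_
    have hp := one_le_sqrt_sqrt (hK.trans ht)
    have hp4 := sqrt_sqrt_pow_four t
    have hq4 := sqrt_sqrt_pow_four (t + 1)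
    have hpq : Real.sqrt (Real.sqrt t) ≤ Real.sqrt (Real.sqrt (t + 1 : ℕ)) :=
      Real.sqrt_le_sqrt (Real.sqrt_le_sqrt (by push_cast; linarith))
    set p := Real.sqrt (Real.sqrt t) with hpd
    set q := Real.sqrt (Real.sqrt (t + 1 : ℕ)) with hqd
    have h1 : q ^ 4 - p ^ 4 = 1 := by rw [hp4, hq4]; push_cast; ring
    have hp0 : 0 < p := by linarith
    have hq2 : q ≤ p + 1 := by
      by_contra hcon
      push Not at hcon
      have : (p + 1) ^ 4 ≤ q ^ 4 := by gcongr
      nlinarith [pow_pos hp0 2, pow_pos hp0 3]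
    have h2 : p⁻¹ * p = 1 := inv_mul_cancel₀ hp0.ne'
    -- Write 1 = q⁴ - p⁴ and compare the cofactors of q - p, using q ≤ p + 1 ≤ 2p.
    have h3 : 1 ≤ 4 * p * (q ^ 3 - p ^ 3) := by
      have e1 : q ^ 4 - p ^ 4 = (q - p) * (q ^ 3 + q ^ 2 * p + q * p ^ 2 + p ^ 3) := by ring
      have e2 : 4 * p * (q ^ 3 - p ^ 3) = (q - p) * (4 * p * (q ^ 2 + q * p + p ^ 2)) := by ring
      rw [← h1, e1, e2]
      refine mul_le_mul_of_nonneg_left ?_ (by linarith)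
      have hq2p : q ≤ 2 * p := by linarith
      have hq0 : 0 < q := by linarith
      nlinarith [mul_nonneg (sq_nonneg q) (by linarith : (0 : ℝ) ≤ 2 * p - q),
        mul_pos hp0 (pow_pos hq0 2), mul_pos hq0 (pow_pos hp0 2), pow_pos hp0 3]
    have h4 : p⁻¹ * 1 ≤ p⁻¹ * (4 * p * (q ^ 3 - p ^ 3)) :=
      mul_le_mul_of_nonneg_left h3 (inv_nonneg.2 hp0.le)
    have h5 : p⁻¹ * (4 * p * (q ^ 3 - p ^ 3)) = 4 * (p⁻¹ * p) * (q ^ 3 - p ^ 3) := by ring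
    rw [h5, h2] at h4
    linarith

end ErrorRate

/-! ### The statistic on the good event -/

section Path

open CanonicalExpFamily

variable {Ω : Type*} {K : ℕ} {A : ℕ → Ω → Fin K} {X : ℕ → Ω → ℝ} {x : Ω}

lemma abs_projMean_sub_le {a b p : ℝ} (hp : p ∈ Set.Icc a b) (t : ℕ) (k : Fin K) :
    |projMean A X a b t x k - p| ≤ |empMean A X t x k - p| := by
  have h1 : max a (min b p) = p := by rw [min_eq_right hp.2, max_eq_right hp.1]
  conv_lhs => rw [← h1]
  unfold projMean
  refine (abs_max_sub_max_le_max _ _ _ _).trans ?_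
  rw [sub_self, abs_zero]
  refine max_le (abs_nonneg _) ?_
  refine (abs_min_sub_min_le_max _ _ _ _).trans ?_
  rw [sub_self, abs_zero]
  exact max_le (abs_nonneg _) le_rfl

lemma projMean_mem {a b : ℝ} (h : a ≤ b) (t : ℕ) (k : Fin K) :
    projMean A X a b t x k ∈ Set.Icc a b :=
  ⟨le_max_left _ _, max_le h (min_le_left _ _)⟩

/-- The uniform bound on the deviation of the empirical means at time `s`. -/
lemma abs_empMean_sub_le {μ : Fin K → ℝ} {σ η u : ℝ} (hσ : 0 < σ) (hη : 0 < η) (hu : 1 ≤ u)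
    (hK : 1 ≤ K) {t s : ℕ} (hx : x ∉ badEvent A X μ σ η u t) (hs : s ∈ Finset.Icc 1 t) {k : Fin K}
    (hk : 1 ≤ pulls A s x k) (hk' : Real.sqrt s / (6 * K) ≤ pulls A s x k) :
    |empMean A X s x k - μ k|
      ≤ (2 * σ ^ 2 / η + Real.sqrt (2 * σ ^ 2)) * u * (6 * K) * (Real.sqrt (Real.sqrt s))⁻¹ := by
  have h1 := mul_abs_empMean_sub_le hσ hη (by linarith) hx hs hk
  have hs1 : 1 ≤ s := (Finset.mem_Icc.1 hs).1
  have hq := one_le_sqrt_sqrt hs1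
  rw [← sqrt_sqrt_sq s] at hk'
  set q := Real.sqrt (Real.sqrt s) with hqd
  have hK' : (1 : ℝ) ≤ K := by exact_mod_cast hK
  have hN1 : (1 : ℝ) ≤ pulls A s x k := by exact_mod_cast hk
  set N : ℝ := (pulls A s x k : ℝ) with hN
  set α := 2 * σ ^ 2 / η with hα
  set γ := Real.sqrt (2 * σ ^ 2) with hγ
  have hα0 : 0 ≤ α := by positivity
  have hγ0 : 0 ≤ γ := Real.sqrt_nonneg _
  set n := Real.sqrt N with hn
  have hn1 : 1 ≤ n := Real.one_le_sqrt.2 hN1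
  have hn2 : n ^ 2 = N := Real.sq_sqrt (by linarith)
  have hsu : Real.sqrt u ≤ u := sqrt_le_self_of_one_le hu
  have hsq : Real.sqrt (2 * σ ^ 2 * u * N) = γ * Real.sqrt u * n := by
    rw [Real.sqrt_mul (by positivity), Real.sqrt_mul (by positivity)]
  have h2 : 2 * σ ^ 2 * u / η = α * u := by rw [hα]; ring
  rw [hsq, h2, ← hn2] at h1
  have h3 : n ^ 2 * |empMean A X s x k - μ k| ≤ n * ((α + γ) * u) := by
    have e1 : α * u ≤ n * (α * u) := le_mul_of_one_le_left (by positivity) hn1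
    have e2 : γ * Real.sqrt u * n ≤ n * (γ * u) := by
      rw [mul_comm]
      gcongr
    nlinarith
  have h4 : n * |empMean A X s x k - μ k| ≤ (α + γ) * u := by
    have : n * (n * |empMean A X s x k - μ k|) ≤ n * ((α + γ) * u) := by
      rw [← mul_assoc, ← sq]
      exact h3
    exact le_of_mul_le_mul_left this (by linarith)
  -- Crude form of √N ≥ q/√(6K), using √(6K) ≤ 6K.
  have h5 : q ≤ 6 * K * n := by
    rw [div_le_iff₀ (by positivity)] at hk'
    rw [← hn2] at hk'
    refine (sq_le_sq₀ (by linarith) (by positivity)).1 ?_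
    nlinarith [mul_nonneg (sq_nonneg n) (by nlinarith : (0 : ℝ) ≤ 36 * K ^ 2 - 6 * K)]
  have hq0 : 0 < q := by linarith
  rw [← div_eq_mul_inv, le_div_iff₀ hq0]
  calc |empMean A X s x k - μ k| * q ≤ |empMean A X s x k - μ k| * (6 * K * n) := by gcongr
    _ = (n * |empMean A X s x k - μ k|) * (6 * K) := by ring
    _ ≤ _ := by gcongr

/-- On the good event, the statistic at time `t` is almost `t` times the inverse characteristic
time. -/
lemma ofReal_le_info {F : CanonicalExpFamily} {a b : ℝ} (hab : Set.Icc a b ⊆ F.meanSpace)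
    (h : a ≤ b) {I : Type*} {Q : Problem K I} (hQ : ∀ l ∈ Q.models, ∀ k, l k ∈ Set.Icc a b)
    {μ : Fin K → ℝ} (hμ : μ ∈ Q.models) {i : I} (hi : Q.correct μ = {i})
    (hA : IsTaSSampling A X F Q a b) (hK : 1 ≤ K) {σ η : ℝ} (hσ : 0 < σ) (hη : 0 < η) {t : ℕ}
    (ht : K ≤ t) (hx : x ∉ badEvent A X μ σ η (deviationLevel K t) t) {C : ℝ}
    (hC : 4 * (50 * ((F.natParam b - F.natParam a) * (2 * σ ^ 2 / η + Real.sqrt (2 * σ ^ 2)))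
      + 3 * ((F.natParam b - F.natParam a) * (b - a))) ≤ C) :
    ENNReal.ofReal (((t : ℝ) - Real.sqrt t - 1) * (Q.invCharTime F μ).toReal - errorRate C K t)
      ≤ Q.info F (fun k => (pulls A t x k : ℝ)) (empMean A X t x) i := by
  obtain ⟨hinit, w, v, hwv⟩ := hA
  refine le_iInf₂ fun l hl => ?_
  have hl' := hQ l hl.1
  have hμ' := hQ μ hμ
  refine le_trans (ENNReal.ofReal_le_ofReal ?_)
    (ofReal_le_weightedKL hab (fun k => Nat.cast_nonneg _) hμ' hl' (empMean A X t x))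
  set B := F.natParam b - F.natParam a with hB
  set c₀ := 2 * σ ^ 2 / η + Real.sqrt (2 * σ ^ 2) with hc₀
  set u := deviationLevel K t with hu
  set T := (Q.invCharTime F μ).toReal with hT
  set q := Real.sqrt (Real.sqrt t) with hq
  set d : Fin K → ℝ := fun k => F.divergence (μ k) (l k) with hd
  have hB0 : 0 ≤ B := natParam_sub_nonneg hab h
  have hc0 : 0 ≤ c₀ := by positivity
  have ht1 : 1 ≤ t := hK.trans ht
  have hu1 : 1 ≤ u := one_le_deviationLevel hK ht1
  have hq1 : 1 ≤ q := one_le_sqrt_sqrt ht1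
  have hq2 : q ^ 2 = Real.sqrt t := sqrt_sqrt_sq t
  have hq4 : q ^ 4 = t := sqrt_sqrt_pow_four t
  have hK' : (1 : ℝ) ≤ K := by exact_mod_cast hK
  have hba : 0 ≤ b - a := by linarith
  set D := B * (b - a) with hD
  have hD0 : 0 ≤ D := mul_nonneg hB0 hba
  have hTD : T ≤ D := by
    have := ENNReal.toReal_mono (by simp) (Problem.invCharTime_le hab h hQ hμ hi hl)
    rwa [ENNReal.toReal_ofReal hD0] at this
  have hT0 : 0 ≤ T := ENNReal.toReal_nonneg
  have hd0 : ∀ k, 0 ≤ d k := fun k => divergence_nonneg (hab (hμ' k)) (hab (hl' k))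
  have hdD : ∀ k, d k ≤ D := fun k => by
    refine (divergence_le_mul_abs hab (hμ' k) (hl' k)).trans (mul_le_mul_of_nonneg_left ?_ hB0)
    rw [abs_le]
    constructor <;> linarith [(hμ' k).1, (hμ' k).2, (hl' k).1, (hl' k).2]
  -- The weights of round s lose at most 2BΔ, with Δ the deviation bound at time s; projecting onto
  -- the cube does not increase the deviation because μ lies in it.
  have hround : ∀ s ∈ Finset.Ico K t,
      T - 2 * (B * (c₀ * u * (6 * K) * (Real.sqrt (Real.sqrt s))⁻¹)) ≤ ∑ k, w s x k * d k := by
    intro s hs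
    obtain ⟨hsK, hst⟩ := Finset.mem_Ico.1 hs
    have hΔ0 : 0 ≤ c₀ * u * (6 * K) * (Real.sqrt (Real.sqrt s))⁻¹ := by positivity
    have hΔ : ∀ k, |projMean A X a b s x k - μ k|
        ≤ c₀ * u * (6 * K) * (Real.sqrt (Real.sqrt s))⁻¹ := fun k =>
      (abs_projMean_sub_le (hμ' k) s k).trans (abs_empMean_sub_le hσ hη hu1 hK hx
        (Finset.mem_Icc.2 ⟨hK.trans hsK, hst.le⟩) (one_le_pulls (hinit x) hsK k)
        (sqrt_div_le_pulls hK (hinit x) (fun r hr => (hwv r hr x).2.1.1)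
          (fun r hr => (hwv r hr x).2.2) hsK k))
    have h1 := Problem.invCharTime_le_of_mem_oracleWeights hab h hQ hμ hi
      (fun k => projMean_mem h s k) (hwv s hsK x).1 hl hΔ0 hΔ
    have hnn : 0 ≤ ∑ k, w s x k * d k := Finset.sum_nonneg fun k _ =>
      mul_nonneg ((hwv s hsK x).1.1.1 k) (hd0 k)
    have h2 := ENNReal.toReal_mono (by simp) h1
    rw [ENNReal.toReal_ofReal (add_nonneg hnn (by positivity))] at h2
    linarith
  -- 48 = 2 · 6 · 4: the two Lipschitz losses, the exploration constant and `sum_inv_sqrt_sqrt_le`.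
  have hrounds : ((t : ℝ) - K) * T - 48 * (B * c₀) * u * K * q ^ 3
      ≤ ∑ k, (∑ s ∈ Finset.Ico K t, w s x k) * d k := by
    have h1 := Finset.sum_le_sum hround
    rw [Finset.sum_sub_distrib, Finset.sum_const, Nat.card_Ico, nsmul_eq_mul, Nat.cast_sub ht,
      Finset.sum_comm] at h1
    simp only [← Finset.sum_mul, ← Finset.mul_sum] at h1
    have h2 := mul_le_mul_of_nonneg_left (sum_inv_sqrt_sqrt_le hK ht)
      (show 0 ≤ 2 * (B * (c₀ * u * (6 * K))) by positivity)
    refine le_trans ?_ h1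
    rw [← hq] at h2
    linarith
  have hpulls : ∑ k, (∑ s ∈ Finset.Ico K t, w s x k) * d k - K * ((K * q ^ 2 + K) * D)
      ≤ ∑ k, pulls A t x k * d k := by
    have : (K : ℝ) * ((K * q ^ 2 + K) * D) = ∑ _k : Fin K, (K * q ^ 2 + K) * D := by simp
    rw [this, ← Finset.sum_sub_distrib]
    refine Finset.sum_le_sum fun k _ => ?_
    have h1 := sum_weights_le_pulls hK (hinit x) (fun r hr => (hwv r hr x).1.1)
      (fun r hr => (hwv r hr x).2.1) (fun r hr => (hwv r hr x).2.2) ht k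
    rw [← hq2] at h1
    have h2 := mul_le_mul_of_nonneg_right h1 (hd0 k)
    have h3 := mul_le_mul_of_nonneg_left (hdD k) (show 0 ≤ (K * q ^ 2 + K : ℝ) by positivity)
    linarith
  have hemp : ∑ k, pulls A t x k * (d k - B * |empMean A X t x k - μ k|)
      ≥ ∑ k, pulls A t x k * d k - K * (B * (c₀ * u * q ^ 2)) := by
    have : (K : ℝ) * (B * (c₀ * u * q ^ 2)) = ∑ _k : Fin K, B * (c₀ * u * q ^ 2) := by simp
    rw [this, ← Finset.sum_sub_distrib]
    refine Finset.sum_le_sum fun k _ => ?_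
    have h1 := mul_abs_empMean_sub_le hσ hη (by linarith) hx
      (Finset.mem_Icc.2 ⟨ht1, le_rfl⟩) (one_le_pulls (hinit x) ht k)
    have h2 : Real.sqrt (2 * σ ^ 2 * u * pulls A t x k) ≤ Real.sqrt (2 * σ ^ 2) * u * q ^ 2 := by
      rw [Real.sqrt_mul (by positivity), Real.sqrt_mul (by positivity), hq2]
      have e1 : Real.sqrt u ≤ u := sqrt_le_self_of_one_le hu1
      have e2 : Real.sqrt (pulls A t x k) ≤ Real.sqrt t :=
        Real.sqrt_le_sqrt (by exact_mod_cast pulls_le t x k)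
      gcongr
    have h3 : 2 * σ ^ 2 * u / η ≤ 2 * σ ^ 2 / η * u * q ^ 2 := by
      have : 2 * σ ^ 2 * u / η = 2 * σ ^ 2 / η * u := by ring
      rw [this]
      exact le_mul_of_one_le_right (by positivity) (one_le_pow₀ hq1)
    have h4 : pulls A t x k * |empMean A X t x k - μ k| ≤ c₀ * u * q ^ 2 := by
      rw [hc₀]
      linarith
    have h5 := mul_le_mul_of_nonneg_left h4 hB0
    linarith
  refine le_trans ?_ hemp
  have hlevel : u ≤ 4 * (4 + Real.log K + Real.log t) := deviationLevel_le hK ht1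
  -- The B c₀ losses are 48 from the rounds and 1 from the empirical means in the statistic. The D
  -- losses are 2 from tracking and 1 from the K initial rounds. The extra factor 4 in C pays for
  -- `deviationLevel_le`.
  have hrate : (50 * (B * c₀) + 3 * D) * (K ^ 2 * u * q ^ 3) ≤ errorRate C K t := by
    unfold errorRate
    have e0 : 0 ≤ 50 * (B * c₀) + 3 * D := by positivity
    calc (50 * (B * c₀) + 3 * D) * (K ^ 2 * u * q ^ 3)
        ≤ (50 * (B * c₀) + 3 * D) * (K ^ 2 * (4 * (4 + Real.log K + Real.log t)) * q ^ 3) := by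
          gcongr
      _ = (4 * (50 * (B * c₀) + 3 * D)) *
          (K ^ 2 * (4 + Real.log K + Real.log t) * q ^ 3) := by ring
      _ ≤ C * (K ^ 2 * (4 + Real.log K + Real.log t) * q ^ 3) := by
          refine mul_le_mul_of_nonneg_right hC ?_
          have : 0 ≤ 4 + Real.log K + Real.log t := by linarith
          positivity
      _ = _ := by rw [← hq]; ring
  have hKK : (K : ℝ) ≤ K ^ 2 := by nlinarith
  have hq23 : q ^ 2 ≤ q ^ 3 := by
    rw [pow_succ q 2]
    exact le_mul_of_one_le_right (by positivity) hq1
  have hq3 : 1 ≤ q ^ 3 := one_le_pow₀ hq1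
  have f1 : 48 * (B * c₀) * u * K * q ^ 3 ≤ 48 * (B * c₀) * (K ^ 2 * u * q ^ 3) := by
    calc 48 * (B * c₀) * u * K * q ^ 3 = 48 * (B * c₀) * (K * u * q ^ 3) := by ring
      _ ≤ _ := by gcongr
  have f2 : K * ((K * q ^ 2 + K) * D) ≤ 2 * D * (K ^ 2 * u * q ^ 3) := by
    have e1 : (1 : ℝ) * (q ^ 2 + 1) ≤ u * (q ^ 3 + q ^ 3) := by gcongr
    calc K * ((K * q ^ 2 + K) * D) = D * K ^ 2 * (1 * (q ^ 2 + 1)) := by ring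
      _ ≤ D * K ^ 2 * (u * (q ^ 3 + q ^ 3)) := by gcongr
      _ = _ := by ring
  have f3 : K * (B * (c₀ * u * q ^ 2)) ≤ (B * c₀) * (K ^ 2 * u * q ^ 3) := by
    calc K * (B * (c₀ * u * q ^ 2)) = B * c₀ * (K * u * q ^ 2) := by ring
      _ ≤ _ := by gcongr
  have f4 : K * T ≤ D * (K ^ 2 * u * q ^ 3) := by
    calc K * T ≤ K ^ 2 * D := by gcongr
      _ = D * (K ^ 2 * 1 * 1) := by ring
      _ ≤ _ := by gcongr
  -- The term (√t + 1)T is pure slack in this estimate.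
  have f5 : 0 ≤ (q ^ 2 + 1) * T := by positivity
  have f6 : 0 ≤ B * c₀ * (K ^ 2 * u * q ^ 3) := by positivity
  rw [← hq2]
  linarith

end Path

/-! ### Persistence of the condition defining T₀ -/

section BoundTime

variable {β : ℕ → ℝ → ℝ} {δ : ℝ}

/-- By concavity the next increment is at most the mean slope from 1 to t, and the value at 1 is
nonnegative. Thus β(t)/(t - 1) is nonincreasing for t ≥ 2. -/
lemma IsThreshold.mul_succ_le (hβ : IsThreshold β) (hδ : δ ∈ Set.Ioo (0 : ℝ) 1) {t : ℕ}
    (ht : 1 ≤ t) : ((t : ℝ) - 1) * β (t + 1) δ ≤ t * β t δ := by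
  have key : ((t : ℝ) - 1) * (β (t + 1) δ - β t δ) ≤ β t δ - β 1 δ := by
    induction t, ht using Nat.le_induction with
    | base => simp
    | succ t ht ih =>
      have h1 := hβ.concave δ hδ t ht
      have ht' : (0 : ℝ) ≤ t := Nat.cast_nonneg t
      have h2 := mul_le_mul_of_nonneg_left h1 ht'
      push_cast
      linarith
  have := hβ.nonneg δ hδ 1 le_rfl
  linarith

lemma errorRate_nonneg {C : ℝ} (hC : 0 ≤ C) {K t : ℕ} (hK : 1 ≤ K) (ht : 1 ≤ t) :
    0 ≤ errorRate C K t := by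
  have h1 : 0 ≤ Real.log K := Real.log_nonneg (by exact_mod_cast hK)
  have h2 : 0 ≤ Real.log t := Real.log_nonneg (by exact_mod_cast ht)
  unfold errorRate
  positivity

lemma errorRate_eq (C : ℝ) (K t : ℕ) :
    errorRate C K t = C * K ^ 2 * (4 + Real.log K + 4 * Real.log (Real.sqrt (Real.sqrt t)))
      * Real.sqrt (Real.sqrt t) ^ 3 := by
  have h : Real.log t = 4 * Real.log (Real.sqrt (Real.sqrt t)) := by
    conv_lhs => rw [← sqrt_sqrt_pow_four t, Real.log_pow]
    norm_num
  rw [errorRate, h]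

/-- The map q ↦ (L + 4 log q)/q is nonincreasing on [1, ∞) as soon as L ≥ 4; hence the constant 4 in
`errorRate`. With q = t^(1/4), it makes `errorRate` divided by t nonincreasing. -/
lemma mul_add_log_le {p q L : ℝ} (hp : 1 ≤ p) (hpq : p ≤ q) (hL : 4 ≤ L) :
    p * (L + 4 * Real.log q) ≤ q * (L + 4 * Real.log p) := by
  have hp0 : 0 < p := by linarith
  have hlp : 0 ≤ Real.log p := Real.log_nonneg hp
  have h1 : Real.log q ≤ Real.log p + (q / p - 1) := by
    have := Real.log_le_sub_one_of_pos (div_pos (by linarith : 0 < q) hp0)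
    rw [Real.log_div (by linarith) hp0.ne'] at this
    linarith
  have h2 : p * Real.log q ≤ p * Real.log p + (q - p) := by
    calc p * Real.log q ≤ p * (Real.log p + (q / p - 1)) := by gcongr
      _ = p * Real.log p + (q - p) := by field_simp
  nlinarith [mul_nonneg (sub_nonneg.2 hpq) hlp, mul_nonneg (sub_nonneg.2 hpq) (sub_nonneg.2 hL)]

lemma mul_errorRate_succ_le {C : ℝ} (hC : 0 ≤ C) {K t : ℕ} (hK : 1 ≤ K) (ht : 1 ≤ t) :
    t * errorRate C K (t + 1) ≤ (t + 1) * errorRate C K t := by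
  have hlK : 0 ≤ Real.log K := Real.log_nonneg (by exact_mod_cast hK)
  have hp := one_le_sqrt_sqrt ht
  have hpq : Real.sqrt (Real.sqrt t) ≤ Real.sqrt (Real.sqrt (t + 1 : ℕ)) :=
    Real.sqrt_le_sqrt (Real.sqrt_le_sqrt (by push_cast; linarith))
  have hp4 := sqrt_sqrt_pow_four t
  have hq4 := sqrt_sqrt_pow_four (t + 1)
  rw [errorRate_eq, errorRate_eq]
  set p := Real.sqrt (Real.sqrt t)
  set q := Real.sqrt (Real.sqrt (t + 1 : ℕ))
  have h1 : (t : ℝ) + 1 = q ^ 4 := by rw [hq4]; push_cast; rfl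
  rw [h1, ← hp4]
  have h2 := mul_add_log_le hp hpq (show 4 ≤ 4 + Real.log K by linarith)
  have hq0 : 0 ≤ q := by linarith
  calc p ^ 4 * (C * K ^ 2 * (4 + Real.log K + 4 * Real.log q) * q ^ 3)
      = C * K ^ 2 * p ^ 3 * q ^ 3 * (p * (4 + Real.log K + 4 * Real.log q)) := by ring
    _ ≤ C * K ^ 2 * p ^ 3 * q ^ 3 * (q * (4 + Real.log K + 4 * Real.log p)) := by gcongr
    _ = _ := by ring

/-- Once the condition that defines the bound on the stopping time holds, it holds for ever. -/
lemma IsThreshold.le_of_le (hβ : IsThreshold β) (hδ : δ ∈ Set.Ioo (0 : ℝ) 1) {C T : ℝ}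
    (hC : 0 ≤ C) (hT : 0 < T) {K n t : ℕ} (hK : 1 ≤ K) (hn : 1 ≤ n)
    (h : β n δ ≤ ((n : ℝ) - Real.sqrt n - 1) * T - errorRate C K n) (hnt : n ≤ t) :
    β t δ ≤ ((t : ℝ) - Real.sqrt t - 1) * T - errorRate C K t := by
  induction t, hnt using Nat.le_induction with
  | base => exact h
  | succ t hnt ih =>
    have ht : 1 ≤ t := hn.trans hnt
    have h0 := hβ.nonneg δ hδ t ht
    have hg0 := errorRate_nonneg hC hK ht
    have ht2 : 2 ≤ t := by
      by_contra hcon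
      -- At t = 1 the right side is at most -T < 0, so the condition fails.
      obtain rfl : t = 1 := by omega
      simp only [Nat.cast_one, Real.sqrt_one] at ih
      linarith
    have ht2' : (2 : ℝ) ≤ t := by exact_mod_cast ht2
    have h1 := hβ.mul_succ_le hδ ht
    have h2 := mul_errorRate_succ_le hC hK ht
    have h3 : ((t : ℝ) - 1) * errorRate C K (t + 1) ≤ t * errorRate C K t := by
      have : (t : ℝ) * (((t : ℝ) - 1) * errorRate C K (t + 1)) ≤ t * (t * errorRate C K t) := by
        have := mul_le_mul_of_nonneg_left h2 (show (0 : ℝ) ≤ t - 1 by linarith)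
        nlinarith
      exact le_of_mul_le_mul_left this (by linarith)
    have h4 : ((t : ℝ) - 1) * Real.sqrt (t + 1) ≤ t * Real.sqrt t := by
      refine (sq_le_sq₀ (mul_nonneg (by linarith) (Real.sqrt_nonneg _)) (by positivity)).1 ?_
      rw [mul_pow, mul_pow, Real.sq_sqrt (by linarith), Real.sq_sqrt (by linarith)]
      nlinarith
    have h5 := mul_le_mul_of_nonneg_left ih (show (0 : ℝ) ≤ t by linarith)
    have h6 := mul_le_mul_of_nonneg_right h4 hT.le
    push_cast
    -- The -1 next to √t makes the induction close: t(t - 1)T is exactly t - 1 times the leading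
    -- term at t + 1.
    refine le_of_mul_le_mul_left (?_ : ((t : ℝ) - 1) * _ ≤ (t - 1) * _) (by linarith)
    linarith

lemma iInf_cast_eq_top_or_mem (S : Set ℕ) :
    (⨅ t ∈ S, (t : ℕ∞)) = ⊤ ∨ ∃ t ∈ S, (⨅ t ∈ S, (t : ℕ∞)) = t := by
  rcases S.eq_empty_or_nonempty with rfl | hS
  · left
    simp
  · right
    have := csInf_mem (hS.image (fun t : ℕ => (t : ℕ∞)))
    rw [sInf_image] at this
    obtain ⟨t, ht, h⟩ := this
    exact ⟨t, ht, h.symm⟩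

lemma boundTime_condition_iff {x g y : ℝ} {T : ℝ≥0∞} (hT : T ≠ ⊤) :
    ((x : ℝ) : EReal) ≤ ((y : ℝ) : EReal) * (T : EReal) - ((g : ℝ) : EReal)
      ↔ x ≤ y * T.toReal - g := by
  rw [← EReal.coe_toReal (x := (T : EReal)) (by simpa using hT) (by simp), EReal.toReal_coe_ennreal]
  norm_cast

end BoundTime

/-! ### From bad events to the expected stopping time -/

section ExpectedStop

variable {Ω : Type*} {K : ℕ} {A : ℕ → Ω → Fin K} {X : ℕ → Ω → ℝ}

lemma stopTime_le {I : Type*} {F : CanonicalExpFamily} {Q : Problem K I} {β : ℕ → ℝ → ℝ} {δ : ℝ}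
    {x : Ω} {t : ℕ} (ht : K ≤ t) (h : ENNReal.ofReal (β t δ) ≤ stopStat A X F Q t x) :
    (stopTime A X F Q β δ x : ℝ≥0∞) ≤ t := by
  have : stopTime A X F Q β δ x ≤ t := iInf₂_le t ⟨ht, h⟩
  exact_mod_cast (ENat.toENNReal_le.2 this)

/-- If M + n is the first good time from M on, the n preceding times are bad and are counted by the
sum; if there is no good time, the sum is infinite. -/
lemma stopTime_le_add_tsum {I : Type*} {F : CanonicalExpFamily} {Q : Problem K I}
    {β : ℕ → ℝ → ℝ} {δ : ℝ} {M : ℕ} {bad : ℕ → Set Ω} (hM : K ≤ M)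
    (h : ∀ t, M ≤ t → ∀ x, x ∉ bad t → ENNReal.ofReal (β t δ) ≤ stopStat A X F Q t x) (x : Ω) :
    (stopTime A X F Q β δ x : ℝ≥0∞)
      ≤ M + ∑' n : ℕ, (bad (M + n)).indicator (fun _ => (1 : ℝ≥0∞)) x := by
  classical
  by_cases hx : ∃ n, x ∉ bad (M + n)
  · have hspec := Nat.find_spec hx
    set n := Nat.find hx with hn
    refine (stopTime_le (t := M + n) (by omega) (h _ (by omega) x hspec)).trans ?_
    push_cast
    gcongr
    calc (n : ℝ≥0∞) = ∑ j ∈ Finset.range n, (bad (M + j)).indicator (fun _ => (1 : ℝ≥0∞)) x := by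
          rw [Finset.sum_congr rfl fun j hj => ?_, Finset.sum_const, Finset.card_range,
            nsmul_eq_mul, mul_one]
          have := Nat.find_min hx (Finset.mem_range.1 hj)
          exact Set.indicator_of_mem (not_not.1 this) _
      _ ≤ _ := ENNReal.sum_le_tsum _
  · push Not at hx
    simp only [Set.indicator_of_mem (hx _)]
    rw [ENNReal.tsum_const_eq_top_of_ne_zero one_ne_zero]
    simp

lemma tsum_inv_sq_le {M : ℕ} :
    ∑' n : ℕ, ENNReal.ofReal (1 / (4 * ((M + n : ℕ) : ℝ) ^ 2))
      ≤ ENNReal.ofReal (Real.pi ^ 2 / 24) := by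
  have h1 := ENNReal.tsum_comp_le_tsum_of_injective (add_right_injective M)
    (fun n : ℕ => ENNReal.ofReal (1 / (4 * (n : ℝ) ^ 2)))
  refine h1.trans_eq ?_
  have h2 : HasSum (fun n : ℕ => 1 / (4 * (n : ℝ) ^ 2)) (Real.pi ^ 2 / 24) := by
    have := hasSum_zeta_two.mul_left (1 / 4)
    simp only [div_mul_div_comm, one_mul] at this
    rwa [show (4 : ℝ) * 6 = 24 by norm_num] at this
  rw [← ENNReal.ofReal_tsum_of_nonneg (fun n => by positivity) h2.summable, h2.tsum_eq]

/-- The union bound has 2Kt² terms; the argument 8Kt⁴ in `deviationLevel` is chosen to leave a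
summable 1/(4t²). -/
lemma measure_badEvent_le_inv_sq [MeasurableSpace Ω] {F : CanonicalExpFamily} {P : Measure Ω}
    [IsProbabilityMeasure P] {μ : Fin K → ℝ} (h : IsInteraction A X F P μ) {Θ : Set ℝ} {σ η : ℝ}
    (hS : F.SubGaussianOn Θ σ) (hσ : 0 < σ) (hΘ : Θ ⊆ F.meanSpace) (hη : 0 < η)
    (hμ : ∀ k, Set.Icc (μ k - η) (μ k + η) ⊆ Θ) (hK : 1 ≤ K) {t : ℕ} (ht : 1 ≤ t) :
    P (badEvent A X μ σ η (deviationLevel K t) t) ≤ ENNReal.ofReal (1 / (4 * (t : ℝ) ^ 2)) := by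
  have hu := one_le_deviationLevel hK ht
  refine (h.measure_badEvent_le hS hσ hΘ hη (by linarith) hμ t).trans_eq ?_
  have hK' : (0 : ℝ) < K := by exact_mod_cast hK
  have ht' : (0 : ℝ) < t := by exact_mod_cast ht
  rw [exp_neg_deviationLevel hK ht, ← ENNReal.ofReal_natCast K, ← ENNReal.ofReal_natCast t,
    ← ENNReal.ofReal_ofNat 2, ← ENNReal.ofReal_mul (by norm_num), ← ENNReal.ofReal_mul ht'.le,
    ← ENNReal.ofReal_mul ht'.le, ← ENNReal.ofReal_mul hK'.le]
  congr 1
  field_simp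
  norm_num

lemma natCast_le_ten_mul_pow (hK : 1 ≤ K) : (K : ℝ≥0∞) ≤ 10 * (K : ℝ≥0∞) ^ 4 := by
  have : K ≤ 10 * K ^ 4 := by
    have : K ^ 1 ≤ K ^ 4 := Nat.pow_le_pow_right hK (by norm_num)
    rw [pow_one] at this
    omega
  exact_mod_cast this

lemma expectedStop_le_of_stopStat [MeasurableSpace Ω] {I : Type*} {F : CanonicalExpFamily}
    {Q : Problem K I} {P : Measure Ω} [IsProbabilityMeasure P] {β : ℕ → ℝ → ℝ} {δ : ℝ} {n : ℕ}
    {bad : ℕ → Set Ω} (hK : 1 ≤ K) (hbad : ∀ t, MeasurableSet (bad t))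
    (hP : ∀ t, 1 ≤ t → P (bad t) ≤ ENNReal.ofReal (1 / (4 * (t : ℝ) ^ 2)))
    (h : ∀ t, K ≤ t → n ≤ t → ∀ x, x ∉ bad t →
      ENNReal.ofReal (β t δ) ≤ stopStat A X F Q t x) :
    expectedStop A X F Q β P δ
      ≤ 10 * (K : ℝ≥0∞) ^ 4 + ENNReal.ofReal (Real.pi ^ 2 / 24) + n := by
  set M := max K n with hM
  have h1 := stopTime_le_add_tsum (A := A) (X := X) (F := F) (Q := Q) (β := β) (δ := δ) (M := M)
    (bad := bad) (le_max_left _ _) fun t ht x hx =>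
      h t ((le_max_left _ _).trans ht) ((le_max_right _ _).trans ht) x hx
  unfold expectedStop
  refine (lintegral_mono h1).trans ?_
  rw [lintegral_add_left measurable_const, lintegral_const, measure_univ, mul_one,
    lintegral_tsum fun m => (measurable_const.indicator (hbad _)).aemeasurable]
  simp only [lintegral_indicator_const (hbad _), one_mul]
  have h2 : ∑' m, P (bad (M + m)) ≤ ENNReal.ofReal (Real.pi ^ 2 / 24) :=
    (ENNReal.tsum_le_tsum fun m => hP (M + m) (by omega)).trans tsum_inv_sq_le
  have h3 : (M : ℝ≥0∞) ≤ 10 * (K : ℝ≥0∞) ^ 4 + n := by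
    have : M ≤ K + n := by omega
    calc (M : ℝ≥0∞) ≤ (K + n : ℕ) := by exact_mod_cast this
      _ ≤ _ := by push_cast; gcongr; exact natCast_le_ten_mul_pow hK
  calc (M : ℝ≥0∞) + ∑' m, P (bad (M + m))
      ≤ (10 * (K : ℝ≥0∞) ^ 4 + n) + ENNReal.ofReal (Real.pi ^ 2 / 24) := add_le_add h3 h2
    _ = _ := by ring

/-- The non-asymptotic bound. -/
theorem expectedStop_le_stopBound [MeasurableSpace Ω] {F : CanonicalExpFamily} {Θ : Set ℝ}
    (hΘ : Θ ⊆ F.meanSpace) {σ η a b : ℝ} (hσ : 0 < σ) (hS : F.SubGaussianOn Θ σ) (hη : 0 < η)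
    (hab : Set.Icc (a - η) (b + η) ⊆ Θ) (h : a ≤ b) (hK : 1 ≤ K) {I : Type*} {Q : Problem K I}
    (hQ : ∀ l ∈ Q.models, ∀ k, l k ∈ Set.Icc a b) {μ : Fin K → ℝ} (hμ : μ ∈ Q.models) {i : I}
    (hi : Q.correct μ = {i}) {β : ℕ → ℝ → ℝ} (hβ : IsThreshold β) {P : Measure Ω}
    [IsProbabilityMeasure P] (hA : IsInteraction A X F P μ) (hTaS : IsTaSSampling A X F Q a b)
    {C : ℝ} (hC : 4 * (50 * ((F.natParam b - F.natParam a)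
        * (2 * σ ^ 2 / η + Real.sqrt (2 * σ ^ 2)))
      + 3 * ((F.natParam b - F.natParam a) * (b - a))) ≤ C) {δ : ℝ} (hδ : δ ∈ Set.Ioo (0 : ℝ) 1) :
    expectedStop A X F Q β P δ
      ≤ stopBound K β (errorRate C K) (Q.invCharTime F μ) δ := by
  have habΘ : Set.Icc a b ⊆ Θ := (Set.Icc_subset_Icc (by linarith) (by linarith)).trans hab
  have hab' : Set.Icc a b ⊆ F.meanSpace := habΘ.trans hΘ
  have hB := CanonicalExpFamily.natParam_sub_nonneg hab' h
  have hC0 : 0 ≤ C := by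
    have : 0 ≤ b - a := by linarith
    exact le_trans (by positivity) hC
  have hμη : ∀ k, Set.Icc (μ k - η) (μ k + η) ⊆ Θ := fun k =>
    (Set.Icc_subset_Icc (by linarith [(hQ μ hμ k).1]) (by linarith [(hQ μ hμ k).2])).trans hab
  unfold stopBound
  rcases iInf_cast_eq_top_or_mem {t : ℕ | 1 ≤ t ∧
    ((β t δ : ℝ) : EReal) ≤ (((t : ℝ) - Real.sqrt t - 1 : ℝ) : EReal) * (Q.invCharTime F μ : EReal)
      - ((errorRate C K t : ℝ) : EReal)} with htop | ⟨n, ⟨hn1, hn⟩, hmem⟩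
  · unfold boundTime
    rw [htop]
    simp
  unfold boundTime
  rw [hmem]
  refine expectedStop_le_of_stopStat hK
    (fun t => hA.measurableSet_badEvent σ η (deviationLevel K t) t)
    (fun t ht => measure_badEvent_le_inv_sq hA hS hσ hΘ hη hμη hK ht)
    fun t htK hnt x hx => ?_
  refine le_trans ?_ (le_iSup _ i)
  rcases (Q.alt i).eq_empty_or_nonempty with hempty | ⟨l, hl⟩
  · rw [Problem.info_eq_top hempty]
    exact le_top
  have hfin : Q.invCharTime F μ ≠ ⊤ :=
    ((Problem.invCharTime_le hab' h hQ hμ hi hl).trans_lt ENNReal.ofReal_lt_top).ne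
  refine le_trans (ENNReal.ofReal_le_ofReal ?_)
    (ofReal_le_info hab' h hQ hμ hi hTaS hK hσ hη htK hx hC)
  exact hβ.le_of_le hδ hC0
    (ENNReal.toReal_pos (Problem.invCharTime_pos hK hσ hS hΘ habΘ hQ hμ).ne' hfin) hK hn1
    ((boundTime_condition_iff hfin).1 hn) hnt

end ExpectedStop

/-! ### Asymptotic optimality -/

section Asymptotics

open Asymptotics in
lemma eventually_error_le (C T c : ℝ) (K : ℕ) {ε : ℝ} (hε : 0 < ε) :
    ∀ᶠ t : ℕ in atTop, Real.sqrt t * T + T + errorRate C K t + c ≤ ε * t := by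
  have hq : Tendsto (fun t : ℕ => Real.sqrt (Real.sqrt t)) atTop atTop :=
    Real.tendsto_sqrt_atTop.comp (Real.tendsto_sqrt_atTop.comp tendsto_natCast_atTop_atTop)
  -- In the variable q = t^(1/4) everything is a power times a logarithm, to be compared with q⁴ =
  -- t.
  have h1 : (fun q : ℝ => (4 + Real.log K + 4 * Real.log q)) =o[atTop] (fun q : ℝ => q) :=
    (isLittleO_const_id_atTop _).add (Real.isLittleO_log_id_atTop.const_mul_left 4)
  have h2 : (fun q : ℝ => C * K ^ 2 * ((4 + Real.log K + 4 * Real.log q) * q ^ 3))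
      =o[atTop] (fun q : ℝ => q ^ 4) := by
    refine IsLittleO.const_mul_left ?_ _
    have := h1.mul_isBigO (isBigO_refl (fun q : ℝ => q ^ 3) atTop)
    refine this.congr_right fun q => by ring
  have h3 : (fun q : ℝ => T * q ^ 2) =o[atTop] (fun q : ℝ => q ^ 4) :=
    (isLittleO_pow_pow_atTop_of_lt (by norm_num)).const_mul_left T
  have h4 : (fun q : ℝ => (T + c) * q ^ 0) =o[atTop] (fun q : ℝ => q ^ 4) :=
    (isLittleO_pow_pow_atTop_of_lt (by norm_num)).const_mul_left _
  have h5 := hq.eventually (((h3.add h2).add h4).def hε)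
  filter_upwards [h5] with t ht
  have h6 := (le_abs_self _).trans ht
  rw [Real.norm_eq_abs, abs_of_nonneg (by positivity), sqrt_sqrt_pow_four, sqrt_sqrt_sq] at h6
  rw [errorRate_eq]
  linarith

lemma boundTime_le {β : ℕ → ℝ → ℝ} {g : ℕ → ℝ} {T : ℝ≥0∞} {δ : ℝ} {t : ℕ} (ht : 1 ≤ t)
    (h : ((β t δ : ℝ) : EReal) ≤ (((t : ℝ) - Real.sqrt t - 1 : ℝ) : EReal) * (T : EReal)
      - ((g t : ℝ) : EReal)) : boundTime β g T δ ≤ t :=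
  iInf₂_le t ⟨ht, h⟩

lemma boundTime_top_le (β : ℕ → ℝ → ℝ) (g : ℕ → ℝ) (δ : ℝ) : boundTime β g ⊤ δ ≤ (4 : ℕ) := by
  refine boundTime_le (by norm_num) ?_
  have h1 : Real.sqrt ((4 : ℕ) : ℝ) = 2 := by
    rw [show ((4 : ℕ) : ℝ) = 2 ^ 2 by norm_num]
    exact Real.sqrt_sq (by norm_num)
  rw [h1, EReal.coe_ennreal_top, EReal.coe_mul_top_of_pos (by norm_num), EReal.top_sub_coe]
  exact le_top

lemma IsCalibrated.boundTime_le {β : ℕ → ℝ → ℝ} (hβ : IsCalibrated β) (C : ℝ) (K : ℕ) {T : ℝ≥0∞}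
    (hT : T ≠ ⊤) {ε : ℝ} (hε : 0 < ε) (hεT : 2 * ε < T.toReal) :
    ∃ N : ℕ, ∀ δ ∈ Set.Ioo (0 : ℝ) 1, boundTime β (errorRate C K) T δ
      ≤ (N + ⌈(1 + ε) / (T.toReal - 2 * ε) * Real.log (1 / δ)⌉₊ : ℕ) := by
  obtain ⟨c, hc⟩ := hβ ε hε
  obtain ⟨N, hN⟩ := eventually_atTop.1 (eventually_error_le C T.toReal c K hε)
  refine ⟨N + 1, fun δ hδ => ?_⟩
  set m := ⌈(1 + ε) / (T.toReal - 2 * ε) * Real.log (1 / δ)⌉₊ with hm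
  set t := N + 1 + m with ht
  refine TrackStop.boundTime_le (by omega) ((boundTime_condition_iff hT).2 ?_)
  -- One εt absorbs the growth of the threshold and another the error terms, so (1 + ε) log(1/δ) ≤
  -- (T - 2ε)t is enough.
  have h1 := hc δ hδ t (by omega)
  have h2 := hN t (by omega)
  have h3 : (1 + ε) / (T.toReal - 2 * ε) * Real.log (1 / δ) ≤ t :=
    (Nat.le_ceil _).trans (by exact_mod_cast (by omega : m ≤ t))
  rw [div_mul_eq_mul_div, div_le_iff₀ (by linarith)] at h3
  linarith

lemma limsup_div_log_le {f : ℝ → ℝ≥0∞} {c r : ℝ}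
    (h : ∀ δ ∈ Set.Ioo (0 : ℝ) 1, f δ ≤ ENNReal.ofReal (c + r * Real.log (1 / δ))) :
    limsup (fun δ : ℝ => f δ / ENNReal.ofReal (Real.log (1 / δ))) (𝓝[>] 0)
      ≤ ENNReal.ofReal r := by
  have hlog : Tendsto (fun δ : ℝ => Real.log (1 / δ)) (𝓝[>] 0) atTop := by
    simp only [one_div]
    exact Real.tendsto_log_atTop.comp tendsto_inv_nhdsGT_zero
  have ht : Tendsto (fun δ : ℝ => ENNReal.ofReal (c / Real.log (1 / δ) + r)) (𝓝[>] 0)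
      (𝓝 (ENNReal.ofReal r)) := by
    refine ENNReal.tendsto_ofReal ?_
    simpa using (hlog.const_div_atTop c).add_const r
  rw [← ht.limsup_eq]
  refine limsup_le_limsup ?_
  filter_upwards [Ioo_mem_nhdsGT (show (0 : ℝ) < 1 by norm_num)] with δ hδ
  have hL : 0 < Real.log (1 / δ) := Real.log_pos (by
    rw [one_div]
    exact (one_lt_inv₀ hδ.1).2 hδ.2)
  rw [show c / Real.log (1 / δ) + r = (c + r * Real.log (1 / δ)) / Real.log (1 / δ) by
    field_simp, ENNReal.ofReal_div_of_pos hL]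
  gcongr
  exact h δ hδ

lemma stopBound_le {K : ℕ} {β : ℕ → ℝ → ℝ} {g : ℕ → ℝ} {T : ℝ≥0∞} {δ : ℝ} {n : ℕ}
    (h : boundTime β g T δ ≤ n) :
    stopBound K β g T δ ≤ ENNReal.ofReal (10 * (K : ℝ) ^ 4 + Real.pi ^ 2 / 24 + n) := by
  unfold stopBound
  rw [ENNReal.ofReal_add (by positivity) (by positivity),
    ENNReal.ofReal_add (by positivity) (by positivity), ENNReal.ofReal_mul (by norm_num),
    ENNReal.ofReal_pow (by positivity), ENNReal.ofReal_natCast, ENNReal.ofReal_natCast,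
    ENNReal.ofReal_ofNat]
  gcongr
  exact_mod_cast ENat.toENNReal_le.2 h

lemma IsCalibrated.boundTime_lt_top {β : ℕ → ℝ → ℝ} (hβ : IsCalibrated β) (C : ℝ) (K : ℕ)
    {T : ℝ≥0∞} (hT : 0 < T) {δ : ℝ} (hδ : δ ∈ Set.Ioo (0 : ℝ) 1) :
    boundTime β (errorRate C K) T δ < ⊤ := by
  by_cases hTop : T = ⊤
  · rw [hTop]
    exact (boundTime_top_le _ _ _).trans_lt (ENat.natCast_lt_top _)
  · have hpos := ENNReal.toReal_pos hT.ne' hTop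
    obtain ⟨N, hN⟩ := hβ.boundTime_le C K hTop (ε := T.toReal / 4) (by positivity) (by linarith)
    exact (hN δ hδ).trans_lt (ENat.natCast_lt_top _)

/-- The bound is asymptotically optimal. -/
theorem IsCalibrated.limsup_stopBound_le {β : ℕ → ℝ → ℝ} (hβ : IsCalibrated β) (C : ℝ) (K : ℕ)
    {T : ℝ≥0∞} (hT : 0 < T) :
    limsup (fun δ : ℝ => stopBound K β (errorRate C K) T δ
      / ENNReal.ofReal (Real.log (1 / δ))) (𝓝[>] 0) ≤ T⁻¹ := by
  by_cases hTop : T = ⊤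
  · subst hTop
    rw [ENNReal.inv_top, ← ENNReal.ofReal_zero]
    refine limsup_div_log_le (c := 10 * (K : ℝ) ^ 4 + Real.pi ^ 2 / 24 + (4 : ℕ))
      fun δ _ => ?_
    rw [zero_mul, add_zero]
    exact stopBound_le (boundTime_top_le _ _ _)
  · have hpos := ENNReal.toReal_pos hT.ne' hTop
    set τ := T.toReal with hτ
    have hlim : Tendsto (fun ε : ℝ => ENNReal.ofReal ((1 + ε) / (τ - 2 * ε))) (𝓝[>] 0)
        (𝓝 T⁻¹) := by
      have h1 : T⁻¹ = ENNReal.ofReal ((1 + 0) / (τ - 2 * 0)) := by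
        rw [add_zero, mul_zero, sub_zero, one_div, ENNReal.ofReal_inv_of_pos hpos,
          ENNReal.ofReal_toReal hTop]
      rw [h1]
      refine ENNReal.tendsto_ofReal (Tendsto.mono_left ?_ nhdsWithin_le_nhds)
      refine ContinuousAt.tendsto (f := fun ε : ℝ => (1 + ε) / (τ - 2 * ε)) ?_
      refine ContinuousAt.div (by fun_prop) (by fun_prop) ?_
      simpa using hpos.ne'
    refine ge_of_tendsto hlim ?_
    filter_upwards [Ioo_mem_nhdsGT (show (0 : ℝ) < τ / 4 by positivity)] with ε hε
    have hε0 := hε.1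
    have hετ := hε.2
    obtain ⟨N, hN⟩ := hβ.boundTime_le C K hTop hε0 (by linarith)
    have hr : 0 ≤ (1 + ε) / (τ - 2 * ε) := div_nonneg (by linarith) (by linarith)
    refine limsup_div_log_le (c := 10 * (K : ℝ) ^ 4 + Real.pi ^ 2 / 24 + (N + 1))
      fun δ hδ => (stopBound_le (hN δ hδ)).trans (ENNReal.ofReal_le_ofReal ?_)
    have hL : 0 ≤ Real.log (1 / δ) := Real.log_nonneg (by
      rw [one_div]
      exact (one_le_inv₀ hδ.1).2 hδ.2.le)
    have := (Nat.ceil_lt_add_one (mul_nonneg hr hL)).le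
    push_cast
    linarith

end Asymptotics

/-! ### Choice of the constants -/

section Constants

/-- The t^(3/4) term of the target carries no factor K², so √D_K = (K + 1)² has to supply it. -/
lemma errorRate_le {C : ℝ} (hC : 0 ≤ C) {K t : ℕ} (hK : 1 ≤ K) (ht : 1 ≤ t) :
    errorRate C K t ≤ 4 * C * (1 + Real.log K + Real.log t) ^ 1 *
      ((K : ℝ) ^ 2 * Real.sqrt (((K : ℝ) + 1) ^ 4 * t)
        + Real.sqrt (((K : ℝ) + 1) ^ 4 * (t : ℝ) ^ (3 / 2 : ℝ))) := by
  have hlK : 0 ≤ Real.log K := Real.log_nonneg (by exact_mod_cast hK)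
  have hlt : 0 ≤ Real.log t := Real.log_nonneg (by exact_mod_cast ht)
  have hrpow : (t : ℝ) ^ (3 / 2 : ℝ) = (Real.sqrt (Real.sqrt t) ^ 3) ^ 2 := by
    have h0 : 0 ≤ Real.sqrt (Real.sqrt t) := Real.sqrt_nonneg _
    conv_lhs => rw [← sqrt_sqrt_pow_four t]
    rw [← Real.rpow_natCast, ← Real.rpow_mul h0, ← pow_mul, ← Real.rpow_natCast]
    norm_num
  have h1 : (K : ℝ) ^ 2 * Real.sqrt (Real.sqrt t) ^ 3
      ≤ Real.sqrt (((K : ℝ) + 1) ^ 4 * (t : ℝ) ^ (3 / 2 : ℝ)) := by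
    refine Real.le_sqrt_of_sq_le ?_
    rw [hrpow, mul_pow, ← pow_mul]
    gcongr
    linarith
  have h2 : 0 ≤ (K : ℝ) ^ 2 * Real.sqrt (((K : ℝ) + 1) ^ 4 * t) := by positivity
  unfold errorRate
  calc C * K ^ 2 * (4 + Real.log K + Real.log t) * Real.sqrt (Real.sqrt t) ^ 3
      = C * (4 + Real.log K + Real.log t) * (K ^ 2 * Real.sqrt (Real.sqrt t) ^ 3) := by ring
    _ ≤ C * (4 * (1 + Real.log K + Real.log t)) *
        ((K : ℝ) ^ 2 * Real.sqrt (((K : ℝ) + 1) ^ 4 * t)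
        + Real.sqrt (((K : ℝ) + 1) ^ 4 * (t : ℝ) ^ (3 / 2 : ℝ))) := by
      gcongr <;> linarith
    _ = _ := by ring

lemma exists_Icc_sub_add_subset {Θ : Set ℝ} (hΘ : IsOpen Θ) {a b : ℝ} (h : a ≤ b)
    (hab : Set.Icc a b ⊆ Θ) : ∃ η > 0, Set.Icc (a - η) (b + η) ⊆ Θ := by
  obtain ⟨r, hr, hra⟩ := Metric.isOpen_iff.1 hΘ a (hab ⟨le_rfl, h⟩)
  obtain ⟨r', hr', hrb⟩ := Metric.isOpen_iff.1 hΘ b (hab ⟨h, le_rfl⟩)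
  refine ⟨min r r' / 2, by positivity, fun x hx => ?_⟩
  have h1 : min r r' ≤ r := min_le_left _ _
  have h2 : min r r' ≤ r' := min_le_right _ _
  obtain ⟨hx1, hx2⟩ := hx
  rcases lt_or_ge x a with hxa | hxa
  · refine hra ?_
    rw [Metric.mem_ball, Real.dist_eq, abs_lt]
    constructor <;> linarith
  rcases lt_or_ge b x with hxb | hxb
  · refine hrb ?_
    rw [Metric.mem_ball, Real.dist_eq, abs_lt]
    constructor <;> linarith
  exact hab ⟨hxa, hxb⟩

end Constants

end TrackStop

open TrackStop in
theorem theorem1 :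
    -- `D K` is a constant that depends only on the number of arms
    ∃ D : ℕ → ℝ, (∀ K, 1 ≤ D K) ∧
    ∀ (F : CanonicalExpFamily) (Θ : Set ℝ), IsOpen Θ → Θ ⊆ F.meanSpace →
    ∀ σ : ℝ, 0 < σ → F.SubGaussianOn Θ σ →
    ∀ a b : ℝ, Set.Icc a b ⊆ Θ →
    -- `g` and the hidden constants depend only on the family, `σ` and `[a, b]` (and `g` on `K`)
    ∃ g : ℕ → ℕ → ℝ,
      (∃ (C : ℝ) (p : ℕ), ∀ K t : ℕ, 1 ≤ K → 1 ≤ t →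
        0 ≤ g K t ∧
        g K t ≤ C * (1 + Real.log K + Real.log t) ^ p *
          ((K : ℝ) ^ 2 * Real.sqrt (D K * t) + Real.sqrt (D K * (t : ℝ) ^ (3 / 2 : ℝ)))) ∧
      ∀ (K : ℕ), 1 ≤ K → ∀ (I : Type*) [Finite I] (Q : Problem K I),
        Q.SingleAnswer → (∀ l ∈ Q.models, ∀ k, l k ∈ Set.Icc a b) →
      ∀ μ ∈ Q.models, ∀ β : ℕ → ℝ → ℝ, IsThreshold β →
        -- the non-asymptotic bound
        (∀ (Ω : Type*) [MeasurableSpace Ω] (P : Measure Ω) [IsProbabilityMeasure P]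
            (A : ℕ → Ω → Fin K) (X : ℕ → Ω → ℝ),
            IsInteraction A X F P μ → IsTaSSampling A X F Q a b →
            ∀ δ ∈ Set.Ioo (0 : ℝ) 1,
              expectedStop A X F Q β P δ ≤ stopBound K β (g K) (Q.invCharTime F μ) δ) ∧
        -- it is finite and recovers asymptotic optimality
        (IsCalibrated β →
          (∀ δ ∈ Set.Ioo (0 : ℝ) 1, boundTime β (g K) (Q.invCharTime F μ) δ < ⊤) ∧
          limsup (fun δ : ℝ => stopBound K β (g K) (Q.invCharTime F μ) δ
              / ENNReal.ofReal (Real.log (1 / δ))) (𝓝[>] 0)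
            ≤ (Q.invCharTime F μ)⁻¹ ∧
          ∀ (Ω : Type*) [MeasurableSpace Ω] (P : Measure Ω) [IsProbabilityMeasure P]
            (A : ℕ → Ω → Fin K) (X : ℕ → Ω → ℝ),
            IsInteraction A X F P μ → IsTaSSampling A X F Q a b →
            limsup (fun δ : ℝ => expectedStop A X F Q β P δ
                / ENNReal.ofReal (Real.log (1 / δ))) (𝓝[>] 0)
              ≤ (Q.invCharTime F μ)⁻¹) := by
  refine ⟨fun K => ((K : ℝ) + 1) ^ 4, fun K => one_le_pow₀ (by simp), ?_⟩
  intro F Θ hΘo hΘ σ hσ hS a b hab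
  by_cases h : a ≤ b
  swap
  -- If a > b the interval is empty and no model exists.
  · refine ⟨fun _ _ => 0, ⟨0, 0, fun K t _ _ => by simp⟩, ?_⟩
    intro K hK I _ Q _ hQ μ hμ
    have := hQ μ hμ ⟨0, hK⟩
    exact absurd (this.1.trans this.2) h
  obtain ⟨η, hη, hηΘ⟩ := exists_Icc_sub_add_subset hΘo h hab
  have hB := CanonicalExpFamily.natParam_sub_nonneg (hab.trans hΘ) h
  obtain ⟨C, hC⟩ : ∃ C, C = 4 * (50 * ((F.natParam b - F.natParam a)
      * (2 * σ ^ 2 / η + Real.sqrt (2 * σ ^ 2)))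
    + 3 * ((F.natParam b - F.natParam a) * (b - a))) := ⟨_, rfl⟩
  have hC0 : 0 ≤ C := by
    have : 0 ≤ b - a := by linarith
    rw [hC]
    positivity
  refine ⟨errorRate C, ⟨4 * C, 1, fun K t hK ht =>
    ⟨errorRate_nonneg hC0 hK ht, errorRate_le hC0 hK ht⟩⟩, ?_⟩
  intro K hK I _ Q hSA hQ μ hμ β hβ
  obtain ⟨i, hi⟩ := hSA μ hμ
  have hT : 0 < Q.invCharTime F μ := Problem.invCharTime_pos hK hσ hS hΘ hab hQ hμ
  refine ⟨fun Ω _ P _ A X hA hTaS δ hδ =>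
    expectedStop_le_stopBound hΘ hσ hS hη hηΘ h hK hQ hμ hi hβ hA hTaS hC.ge hδ,
    fun hcal => ⟨fun δ hδ => hcal.boundTime_lt_top C K hT hδ, hcal.limsup_stopBound_le C K hT,
      fun Ω _ P _ A X hA hTaS => ?_⟩⟩
  refine le_trans (limsup_le_limsup ?_) (hcal.limsup_stopBound_le C K hT)
  filter_upwards [Ioo_mem_nhdsGT (show (0 : ℝ) < 1 by norm_num)] with δ hδ
  gcongr
  exact expectedStop_le_stopBound hΘ hσ hS hη hηΘ h hK hQ hμ hi hβ hA hTaS hC.ge hδ
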